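/- Let $\log$ denote the principal logarithm and $\gamma$ Euler's constant. On $\mathbb C\setminus(-\infty,0]$ let $$\log\Gamma(z)=-\gamma z-\log z-\sum_{n=1}^{\infty}\left(\log\left(1+\frac zn\right)-\frac zn\right),$$ the holomorphic branch of the logarithm of Euler's Gamma function that is real on $(0,\infty)$. A Nevanlinna–Pick function is a holomorphic function on the open upper half-plane whose values lie in the closed upper half-plane. Define $d:\mathbb R\to[-\infty,\infty]$ by $d(t)=0$ for $t\ge 0$, $d(-k)=+\infty$ for $k=1,2,\dots$, and $$d(t)=-\frac{\log|\Gamma(t+1)|+(k-1)\log|t|}{t\left((\log|t|)^2+\pi^2\right)},\qquad t\in(-k,1-k),\ k=1,2,\dots$$ Then $d(t)\ge 0$ for all $t\in\mathbb R$. The function $$f(z)=\frac{\log\Gamma(z+1)}{z\log z},\qquad z\in\mathbb C\setminus(-\infty,0],\ z\ne 1,$$ extends holomorphically to $\mathbb C\setminus(-\infty,0]$. The extension, again denoted by $f$, is real on $(0,\infty)$ and equals the quotient of real numbers $\log(\Gamma(x+1))/(x\log x)$ at each $x>0$, $x\neq1$. Its restriction to the open upper half-plane is a Nevanlinna–Pick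 function. For every $z\in\mathbb C\setminus(-\infty,0]$, $$f(z)=1-\int_0^\infty\frac{d(-t)}{t+z}\,dt,$$ where the integral converges absolutely. Moreover $(-1)^{n-1}f^{(n)}(x)>0$ for all $x>0$ and all integers $n\ge 1$. -/

import Mathlib

open MeasureTheory Set

/-- A Nevanlinna--Pick function: holomorphic in the open upper half-plane, with values in the
closed upper half-plane. -/
def IsNevanlinnaPick (f : ℂ → ℂ) : Prop :=
  DifferentiableOn ℂ f {z | 0 < z.im} ∧ ∀ z : ℂ, 0 < z.im → 0 ≤ (f z).im

/-- The holomorphic branch of `log Γ` on the plane cut along `(-∞, 0]` that is real on `(0, ∞)`: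
`log Γ(z) = -γ z - log z - ∑_{n ≥ 1} (log (1 + z / n) - z / n)`, with principal logarithms
on the right-hand side. The series converges absolutely for every `z` off the cut. -/
noncomputable def complexLogGamma (z : ℂ) : ℂ :=
  -(Real.eulerMascheroniConstant : ℂ) * z - Complex.log z
    - ∑' n : ℕ, (Complex.log (1 + z / ((n : ℂ) + 1)) - z / ((n : ℂ) + 1))

/-- The expression
`-(log |Γ(t + 1)| + (k - 1) log |t|) / (t ((log |t|)² + π²))`, which gives the density on the
interval `(-k, 1 - k)`, for `k ≥ 1`. -/
noncomputable def pickDensityOn (k : ℕ) (t : ℝ) : ℝ :=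
  -(Real.log |Real.Gamma (t + 1)| + ((k : ℝ) - 1) * Real.log |t|)
    / (t * ((Real.log |t|) ^ 2 + Real.pi ^ 2))

open Classical in
/-- The density `d : ℝ → [-∞, ∞]`: it is `0` on `[0, ∞)`, it is `+∞` at the negative integers, and
on `(-k, 1 - k)`, `k ≥ 1`, it is given by `pickDensityOn k` (for such `t` the ceiling of `-t`
is `k`). -/
noncomputable def pickDensity (t : ℝ) : EReal :=
  if 0 ≤ t then 0
  else if ∃ k : ℕ, t = -(k : ℝ) then ⊤
  else ((pickDensityOn ⌈-t⌉₊ t : ℝ) : EReal)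

/-!
The quotient `f z = log Γ (z + 1) / (z log z)` is identified with `1` minus the Stieltjes transform
of the density `d (-t)`; the non-negativity of `d` then gives the Nevanlinna--Pick property
(`isNevanlinnaPick_gammaQuotient`) and the signs of the derivatives
(`iteratedDeriv_gammaQuotient_sign`), and the continuation of `f` to `z = 1` is the integral itself.

The representation is first proved for finite approximations. Let
`L_N z = z log (N + z) - ∑_{n = 1}^N (log (n + z) - log n)` (`approxLogGamma`). It vanishes at
`z = 1`, it converges to `log Γ (z + 1)` (`tendsto_approxLogGamma`), and `L_N z / (z log z)` tends
to `1` at infinity. Only finitely many logarithms occur, so the behaviour at the cut, at `0` and at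
infinity is explicit. In the coordinate `z = e ^ w` the slit plane is the strip `|Im w| < π`, and
Cauchy's theorem on rectangles (`tendsto_integral_strip_jump`) yields
`L_N z / (z log z) = 1 - ∫ t in (0, ∞), d_N t / (t + z)` (`integral_approxDensity`).

The choice of `(N + z) ^ z` in `L_N` makes every `d_N` non-negative. On `(0, N)` the sequence `d_N`
decreases with `N`, and by Euler's limit formula its limit is `d (-t)` (`tendsto_approxDensity`), so
the integrals over bounded intervals converge by domination. The tails are handled by positivity:
at `z` they are at most twice the full integral at a large `x > 0`, which is `1 - L_N x / (x log x)`
(`norm_integral_approxDensity_tail_le`). In the limit `N → ∞` this becomes `1 - f x`, which is small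
because `log n! ~ n log n`. Hence no mass escapes to infinity (`integral_density`).
-/

/-! ### Cauchy's formula on a strip -/

section StripCauchy

open Complex Filter Topology Real Interval

/-- The strip `|Im w| < π`, which `exp` maps biholomorphically onto the slit plane. -/
def principalStrip : Set ℂ := {w | |w.im| < π}

lemma isOpen_principalStrip : IsOpen principalStrip :=
  isOpen_lt (continuous_abs.comp continuous_im) continuous_const

/-- The Cauchy kernel `e ^ w / (e ^ w - e ^ w₀)` applied to `G - G w₀`, with the removable
singularity at `w₀` removed by divided slopes. -/
noncomputable def stripKernel (G : ℂ → ℂ) (w₀ w : ℂ) : ℂ :=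
  dslope G w₀ w * cexp w / dslope cexp w₀ w

lemma stripKernel_of_ne (G : ℂ → ℂ) {w₀ w : ℂ} (h : w ≠ w₀) :
    stripKernel G w₀ w = (G w - G w₀) * (cexp w / (cexp w - cexp w₀)) := by
  have h' : w - w₀ ≠ 0 := sub_ne_zero.2 h
  rw [stripKernel, dslope_of_ne _ h, dslope_of_ne _ h, slope_def_field, slope_def_field]
  by_cases he : cexp w - cexp w₀ = 0
  · simp [he]
  · field_simp

lemma differentiableOn_stripKernel {G : ℂ → ℂ} (hG : DifferentiableOn ℂ G principalStrip)
    {w₀ : ℂ} (hw₀ : w₀ ∈ principalStrip) :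
    DifferentiableOn ℂ (stripKernel G w₀) principalStrip := by
  have hn := isOpen_principalStrip.mem_nhds hw₀
  refine DifferentiableOn.div (DifferentiableOn.mul ((differentiableOn_dslope hn).2 hG)
    differentiable_exp.differentiableOn)
    ((differentiableOn_dslope hn).2 differentiable_exp.differentiableOn) ?_
  intro w hw
  by_cases h : w = w₀
  · subst h
    simp
  · rw [dslope_of_ne _ h, slope_def_field]
    refine div_ne_zero (fun he => h ?_) (sub_ne_zero.2 h)
    have h1 := abs_lt.1 (show |w.im| < π from hw)
    have h2 := abs_lt.1 (show |w₀.im| < π from hw₀)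
    exact exp_inj_of_neg_pi_lt_of_le_pi h1.1 h1.2.le h2.1 h2.2.le (sub_eq_zero.1 he)

lemma exp_ne_exp_of_abs_im_lt {w w₀ : ℂ} (h : |w₀.im| < |w.im|) (hw : |w.im| ≤ π) :
    cexp w ≠ cexp w₀ := by
  intro he
  obtain ⟨n, hn⟩ := exp_eq_exp_iff_exists_int.1 he
  have him : w.im = w₀.im + n * (2 * π) := by
    have := congrArg Complex.im hn
    simpa using this
  have hpi := Real.pi_pos
  have hlt : |(n : ℝ)| * (2 * π) < 1 * (2 * π) := by
    have h1 : (n : ℝ) * (2 * π) = w.im - w₀.im := by linarith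
    calc |(n : ℝ)| * (2 * π) = |w.im - w₀.im| := by
          rw [← h1, abs_mul, abs_of_pos (by positivity : (0 : ℝ) < 2 * π)]
      _ ≤ |w.im| + |w₀.im| := abs_sub _ _
      _ < 1 * (2 * π) := by linarith
  have hn1 : |(n : ℝ)| < 1 := lt_of_mul_lt_mul_right hlt (by positivity)
  have hn0 : n = 0 := by
    have : |n| < 1 := by exact_mod_cast hn1
    exact Int.abs_lt_one_iff.1 this
  rw [hn0] at him
  simp at him
  rw [him] at h
  exact lt_irrefl _ h

lemma abs_sign_mul {s : ℝ} (hs : |s| = 1) {y : ℝ} (hy : 0 ≤ y) : |s * y| = y := by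
  rw [abs_mul, hs, one_mul, abs_of_nonneg hy]

/-- The integral of the Cauchy kernel along a horizontal segment converges as the segment
approaches one of the two edges of the strip; `s = 1` is the upper edge, `s = -1` the lower. -/
lemma tendsto_integral_stripKernel_edge {G : ℂ → ℂ} (hG : DifferentiableOn ℂ G principalStrip)
    {w₀ : ℂ} (hw₀ : w₀ ∈ principalStrip) {s : ℝ} (hs : |s| = 1) {g : ℝ → ℂ} {B : ℝ → ℝ} {R : ℝ}
    (hB : IntervalIntegrable B volume (-R) R)
    (hbound : ∀ᵐ u : ℝ, ∀ y : ℝ, π / 2 ≤ |y| → |y| < π → ‖G (u + y * I)‖ ≤ B u)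
    (hlim : ∀ᵐ u : ℝ, Tendsto (fun y : ℝ => G (u + ((s * y : ℝ) : ℂ) * I)) (𝓝[<] π) (𝓝 (g u))) :
    IntervalIntegrable (fun u : ℝ => (g u - G w₀) * (Real.exp u / (Real.exp u + cexp w₀)))
      volume (-R) R ∧
    Tendsto (fun y : ℝ => ∫ u in (-R)..R, stripKernel G w₀ (u + ((s * y : ℝ) : ℂ) * I)) (𝓝[<] π)
      (𝓝 (∫ u in (-R)..R, (g u - G w₀) * (Real.exp u / (Real.exp u + cexp w₀)))) := by
  have hpi := Real.pi_pos
  have hw₀' : |w₀.im| < π := hw₀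
  -- Beyond height `θ₁` the bound `B` applies and the pole at `w₀` is out of the way.
  set θ₁ : ℝ := max (π / 2) ((|w₀.im| + π) / 2) with hθ₁
  have hθ₁π : θ₁ < π := max_lt (by linarith) (by linarith)
  have hθ₁w : |w₀.im| < θ₁ := lt_of_lt_of_le (by linarith) (le_max_right _ _)
  have hθ₁0 : 0 < θ₁ := lt_of_lt_of_le (by linarith) (le_max_left _ _)
  have hne : ∀ u y : ℝ, θ₁ ≤ y → y ≤ π →
      cexp (u + ((s * y : ℝ) : ℂ) * I) - cexp w₀ ≠ 0 := by
    intro u y h1 h2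
    have him : |(u + ((s * y : ℝ) : ℂ) * I).im| = y := by
      have h3 : (u + ((s * y : ℝ) : ℂ) * I).im = s * y := by simp
      rw [h3, abs_sign_mul hs (hθ₁0.le.trans h1)]
    exact sub_ne_zero.2 (exp_ne_exp_of_abs_im_lt (by rw [him]; linarith) (by rw [him]; exact h2))
  obtain ⟨C, hC⟩ : ∃ C : ℝ, ∀ u ∈ Icc (-|R|) |R|, ∀ y ∈ Icc θ₁ π,
      ‖cexp (u + ((s * y : ℝ) : ℂ) * I) / (cexp (u + ((s * y : ℝ) : ℂ) * I) - cexp w₀)‖ ≤ C := by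
    have hc : ContinuousOn (fun p : ℝ × ℝ => cexp (p.1 + ((s * p.2 : ℝ) : ℂ) * I) /
        (cexp (p.1 + ((s * p.2 : ℝ) : ℂ) * I) - cexp w₀)) (Icc (-|R|) |R| ×ˢ Icc θ₁ π) := by
      refine ContinuousOn.div (by fun_prop) (by fun_prop) ?_
      rintro ⟨u, y⟩ ⟨-, hy⟩
      exact hne u y hy.1 hy.2
    obtain ⟨C, hC⟩ := (isCompact_Icc.prod isCompact_Icc).exists_bound_of_continuousOn hc
    exact ⟨C, fun u hu y hy => hC (u, y) ⟨hu, hy⟩⟩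
  have hnhds : ∀ᶠ y in 𝓝[<] π, θ₁ < y ∧ y < π := by
    filter_upwards [Ioo_mem_nhdsLT hθ₁π] with y hy using hy
  have him : ∀ u y : ℝ, 0 ≤ y → |(u + ((s * y : ℝ) : ℂ) * I).im| = y := by
    intro u y hy
    have h3 : (u + ((s * y : ℝ) : ℂ) * I).im = s * y := by simp
    rw [h3, abs_sign_mul hs hy]
  have hnew : ∀ u y : ℝ, θ₁ < y → (u + ((s * y : ℝ) : ℂ) * I) ≠ w₀ := by
    intro u y hy h
    have := him u y (hθ₁0.trans hy).le
    rw [h] at this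
    linarith
  have hmeas : ∀ y : ℝ, θ₁ < y ∧ y < π → Continuous (fun u : ℝ =>
      stripKernel G w₀ (u + ((s * y : ℝ) : ℂ) * I)) := by
    intro y hy
    refine (differentiableOn_stripKernel hG hw₀).continuousOn.comp_continuous (by fun_prop) ?_
    intro u
    show |_| < π
    rw [him u y (hθ₁0.trans hy.1).le]
    exact hy.2
  have hbd : ∀ y : ℝ, θ₁ < y ∧ y < π → ∀ᵐ u : ℝ, u ∈ Ι (-R) R →
      ‖stripKernel G w₀ (u + ((s * y : ℝ) : ℂ) * I)‖ ≤ (B u + ‖G w₀‖) * C := by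
    intro y hy
    filter_upwards [hbound] with u hu hmem
    rw [stripKernel_of_ne G (hnew u y hy.1), norm_mul]
    have hmem' : u ∈ Icc (-|R|) |R| := by
      have h1 : |u| ≤ |R| := by
        rcases le_total 0 R with h | h
        · rw [uIoc_of_le (by linarith)] at hmem
          rw [abs_of_nonneg h, abs_le]; exact ⟨hmem.1.le, hmem.2⟩
        · rw [uIoc_of_ge (by linarith)] at hmem
          rw [abs_of_nonpos h, abs_le]; exact ⟨by linarith [hmem.1], hmem.2⟩
      exact abs_le.1 h1
    have h1 := hu (s * y) (by rw [abs_sign_mul hs (hθ₁0.trans hy.1).le]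
                              exact (le_max_left _ _).trans hy.1.le)
      (by rw [abs_sign_mul hs (hθ₁0.trans hy.1).le]; exact hy.2)
    gcongr
    · exact add_nonneg ((norm_nonneg _).trans h1) (norm_nonneg _)
    · exact (norm_sub_le _ _).trans (by gcongr)
    · exact hC u hmem' y ⟨hy.1.le, hy.2.le⟩
  have hlim' : ∀ᵐ u : ℝ, u ∈ Ι (-R) R → Tendsto (fun y : ℝ =>
      stripKernel G w₀ (u + ((s * y : ℝ) : ℂ) * I)) (𝓝[<] π)
      (𝓝 ((g u - G w₀) * (Real.exp u / (Real.exp u + cexp w₀)))) := by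
    filter_upwards [hlim] with u hu _
    have hexp : cexp (u + ((s * π : ℝ) : ℂ) * I) = -Real.exp u := by
      rw [Complex.exp_add]
      rcases eq_or_eq_neg_of_abs_eq hs with h | h <;> subst h <;> simp [Complex.exp_neg]
    have hK : Tendsto (fun y : ℝ => cexp (u + ((s * y : ℝ) : ℂ) * I) /
        (cexp (u + ((s * y : ℝ) : ℂ) * I) - cexp w₀)) (𝓝[<] π)
        (𝓝 (Real.exp u / (Real.exp u + cexp w₀))) := by
      have h2 : (Real.exp u / (Real.exp u + cexp w₀) : ℂ) = cexp (u + ((s * π : ℝ) : ℂ) * I) /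
        (cexp (u + ((s * π : ℝ) : ℂ) * I) - cexp w₀) := by
        rw [hexp, ← neg_add', neg_div_neg_eq]
      rw [h2]
      refine Tendsto.mono_left ?_ nhdsWithin_le_nhds
      refine ContinuousAt.tendsto (f := fun y : ℝ => cexp (u + ((s * y : ℝ) : ℂ) * I) /
        (cexp (u + ((s * y : ℝ) : ℂ) * I) - cexp w₀)) ?_
      exact ContinuousAt.div (by fun_prop) (by fun_prop) (hne u π hθ₁π.le le_rfl)
    refine ((hu.sub_const (G w₀)).mul hK).congr' ?_
    filter_upwards [hnhds] with y hy
    rw [stripKernel_of_ne G (hnew u y hy.1)]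
  have hBi := (hB.add (intervalIntegrable_const (c := ‖G w₀‖))).mul_const C
  refine ⟨?_, intervalIntegral.tendsto_integral_filter_of_dominated_convergence
    (fun u => (B u + ‖G w₀‖) * C) (hnhds.mono fun y hy => (hmeas y hy).aestronglyMeasurable)
    (hnhds.mono hbd) hBi hlim'⟩
  obtain ⟨v, -, hv, hvt⟩ := exists_seq_strictMono_tendsto' hθ₁π
  have hvt' : Tendsto v atTop (𝓝[<] π) :=
    tendsto_nhdsWithin_iff.2 ⟨hvt, Eventually.of_forall fun n => (hv n).2⟩
  refine IntervalIntegrable.mono_fun' hBi ?_ ?_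
  · refine aestronglyMeasurable_of_tendsto_ae atTop
      (fun n => (hmeas (v n) (hv n)).aestronglyMeasurable)
      ((ae_restrict_iff' measurableSet_uIoc).2 ?_)
    filter_upwards [hlim'] with u hu hmem using (hu hmem).comp hvt'
  · refine (ae_restrict_iff' measurableSet_uIoc).2 ?_
    filter_upwards [hlim', ae_all_iff.2 fun n => hbd (v n) (hv n)] with u hu hb hmem
    exact le_of_tendsto ((hu hmem).comp hvt').norm (Eventually.of_forall fun n => hb n hmem)

lemma tendsto_stripKernel_right {G : ℂ → ℂ} {ℓ : ℂ} (w₀ : ℂ)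
    (h : Tendsto G (comap re atTop ⊓ 𝓟 principalStrip) (𝓝 ℓ)) :
    Tendsto (stripKernel G w₀) (comap re atTop ⊓ 𝓟 principalStrip) (𝓝 (ℓ - G w₀)) := by
  have hexp : Tendsto cexp (comap re atTop ⊓ 𝓟 principalStrip) (Bornology.cobounded ℂ) :=
    tendsto_exp_comap_re_atTop.mono_left inf_le_left
  have hk : Tendsto (fun w => cexp w / (cexp w - cexp w₀)) (comap re atTop ⊓ 𝓟 principalStrip)
      (𝓝 1) := by
    have h1 : Tendsto (fun w => (1 - cexp w₀ * (cexp w)⁻¹)⁻¹)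
        (comap re atTop ⊓ 𝓟 principalStrip) (𝓝 (1 - cexp w₀ * 0)⁻¹) :=
      ((((tendsto_inv₀_cobounded).comp hexp).const_mul (cexp w₀)).const_sub 1).inv₀ (by simp)
    simp only [mul_zero, sub_zero, inv_one] at h1
    refine h1.congr fun w => ?_
    have := Complex.exp_ne_zero w
    rw [div_eq_mul_inv, ← inv_inv (cexp w), ← mul_inv, inv_inv]
    congr 1
    field_simp
  have h2 := (h.sub_const (G w₀)).mul hk
  rw [mul_one] at h2
  refine h2.congr' ?_
  have hev : ∀ᶠ w : ℂ in comap re atTop ⊓ 𝓟 principalStrip, w₀.re < w.re :=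
    (tendsto_comap.eventually (eventually_gt_atTop w₀.re)).filter_mono inf_le_left
  filter_upwards [hev] with w hw
  rw [stripKernel_of_ne G (by rintro rfl; exact lt_irrefl _ hw)]

lemma tendsto_stripKernel_left {G : ℂ → ℂ} (w₀ : ℂ)
    (h : Tendsto (fun w => cexp w * G w) (comap re atBot ⊓ 𝓟 principalStrip) (𝓝 0)) :
    Tendsto (stripKernel G w₀) (comap re atBot ⊓ 𝓟 principalStrip) (𝓝 0) := by
  have hexp : Tendsto cexp (comap re atBot ⊓ 𝓟 principalStrip) (𝓝 0) :=
    tendsto_exp_comap_re_atBot.mono_left inf_le_left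
  have h1 : Tendsto (fun w => (cexp w * G w - G w₀ * cexp w) * (cexp w - cexp w₀)⁻¹)
      (comap re atBot ⊓ 𝓟 principalStrip) (𝓝 ((0 - G w₀ * 0) * (0 - cexp w₀)⁻¹)) :=
    (h.sub (hexp.const_mul _)).mul ((hexp.sub_const _).inv₀ (by simp [Complex.exp_ne_zero]))
  simp only [mul_zero, sub_zero, zero_mul] at h1
  refine h1.congr' ?_
  have hev : ∀ᶠ w : ℂ in comap re atBot ⊓ 𝓟 principalStrip, w.re < w₀.re :=
    (tendsto_comap.eventually (eventually_lt_atBot w₀.re)).filter_mono inf_le_left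
  filter_upwards [hev] with w hw
  rw [stripKernel_of_ne G (by rintro rfl; exact lt_irrefl _ hw)]
  ring

lemma intervalIntegrable_vertical {H : ℂ → ℂ} (hH : DifferentiableOn ℂ H principalStrip) (x : ℝ)
    {y : ℝ} (hy0 : 0 ≤ y) (hy : y < π) :
    IntervalIntegrable (fun t : ℝ => H (x + t * I)) volume (-y) y := by
  refine ContinuousOn.intervalIntegrable (hH.continuousOn.comp (by fun_prop) ?_)
  intro t ht
  rw [uIcc_of_le (by linarith)] at ht
  show |_| < π
  have : (x + t * I : ℂ).im = t := by simp
  rw [this]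
  exact abs_lt.2 ⟨by linarith [ht.1], by linarith [ht.2]⟩

lemma norm_integral_vertical_sub_le {H : ℂ → ℂ} (hH : DifferentiableOn ℂ H principalStrip) {x : ℝ}
    {L : ℂ} {δ : ℝ} (h : ∀ t : ℝ, |t| < π → ‖H (x + t * I) - L‖ ≤ δ) {y : ℝ} (hy0 : 0 ≤ y)
    (hy : y < π) : ‖(∫ t in (-y)..y, H (x + t * I)) - (2 * y : ℝ) • L‖ ≤ δ * (2 * y) := by
  have h1 : (2 * y : ℝ) • L = ∫ _ in (-y)..y, L := by
    rw [intervalIntegral.integral_const]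
    congr 1
    ring
  rw [h1, ← intervalIntegral.integral_sub (intervalIntegrable_vertical hH x hy0 hy)
    intervalIntegrable_const]
  have h2 := intervalIntegral.norm_integral_le_of_norm_le_const (a := -y) (b := y)
    (f := fun t : ℝ => H (x + t * I) - L) (C := δ) ?_
  · rwa [show |y - -y| = 2 * y by rw [abs_of_nonneg (by linarith)]; ring] at h2
  · intro t ht
    rw [uIoc_of_le (by linarith)] at ht
    exact h t (abs_lt.2 ⟨by linarith [ht.1], by linarith [ht.2]⟩)

/-- **Cauchy's formula on the strip.** The boundary values of `G` on the two edges of the strip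
recover `G`; in the variable `z = e ^ w` this is Cauchy's formula for a keyhole contour around
the cut. The integral is taken as a limit over symmetric intervals, so that no decay of the jump
`g₊ - g₋` is needed. -/
theorem tendsto_integral_strip_jump {G : ℂ → ℂ} (hG : DifferentiableOn ℂ G principalStrip)
    {w₀ : ℂ} (hw₀ : w₀ ∈ principalStrip) {gp gm : ℝ → ℂ} {B : ℝ → ℝ}
    (hB : ∀ R : ℝ, IntervalIntegrable B volume (-R) R)
    (hbound : ∀ᵐ u : ℝ, ∀ y : ℝ, π / 2 ≤ |y| → |y| < π → ‖G (u + y * I)‖ ≤ B u)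
    (hp : ∀ᵐ u : ℝ, Tendsto (fun y : ℝ => G (u + ((1 * y : ℝ) : ℂ) * I)) (𝓝[<] π) (𝓝 (gp u)))
    (hm : ∀ᵐ u : ℝ, Tendsto (fun y : ℝ => G (u + ((-1 * y : ℝ) : ℂ) * I)) (𝓝[<] π) (𝓝 (gm u)))
    {ℓ : ℂ} (hright : Tendsto G (comap re atTop ⊓ 𝓟 principalStrip) (𝓝 ℓ))
    (hleft : Tendsto (fun w => cexp w * G w) (comap re atBot ⊓ 𝓟 principalStrip) (𝓝 0)) :
    Tendsto (fun R : ℝ => ∫ u in (-R)..R,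
      (gp u - gm u) * (Real.exp u / (Real.exp u + cexp w₀))) atTop
      (𝓝 (2 * π * I * (ℓ - G w₀))) := by
  have hpi := Real.pi_pos
  have hdiff := differentiableOn_stripKernel hG hw₀
  rw [Metric.tendsto_nhds]
  intro ε hε
  -- Both vertical sides contribute an error of at most `2 π δ`, in total `ε / 2`.
  set δ : ℝ := ε / (8 * π) with hδ
  have hδ0 : 0 < δ := by positivity
  have e1 := (Metric.tendsto_nhds.1 (tendsto_stripKernel_right w₀ hright)) δ hδ0
  have e2 := (Metric.tendsto_nhds.1 (tendsto_stripKernel_left w₀ hleft)) δ hδ0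
  rw [eventually_inf_principal, eventually_comap] at e1 e2
  filter_upwards [e1, tendsto_neg_atTop_atBot.eventually e2] with R h1 h2
  obtain ⟨ip, tp⟩ := tendsto_integral_stripKernel_edge hG hw₀ (s := 1) (by simp) (hB R) hbound hp
  obtain ⟨im, tm⟩ := tendsto_integral_stripKernel_edge hG hw₀ (s := -1) (by simp) (hB R) hbound hm
  have hmem : ∀ x t : ℝ, |t| < π → (x + t * I : ℂ) ∈ principalStrip := by
    intro x t ht
    show |_| < π
    simpa using ht
  have hJ : (∫ u in (-R)..R, (gp u - gm u) * (Real.exp u / (Real.exp u + cexp w₀))) =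
      (∫ u in (-R)..R, (gp u - G w₀) * (Real.exp u / (Real.exp u + cexp w₀))) -
      ∫ u in (-R)..R, (gm u - G w₀) * (Real.exp u / (Real.exp u + cexp w₀)) := by
    rw [← intervalIntegral.integral_sub ip im]
    congr 1
    ext u
    ring
  have hlim : Tendsto (fun y : ℝ =>
      ‖(∫ u in (-R)..R, stripKernel G w₀ (u + ((1 * y : ℝ) : ℂ) * I)) -
        (∫ u in (-R)..R, stripKernel G w₀ (u + ((-1 * y : ℝ) : ℂ) * I)) -
          I * ((2 * y : ℝ) • (ℓ - G w₀))‖) (𝓝[<] π)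
      (𝓝 ‖(∫ u in (-R)..R, (gp u - gm u) * (Real.exp u / (Real.exp u + cexp w₀))) -
        2 * π * I * (ℓ - G w₀)‖) := by
    rw [hJ]
    refine ((tp.sub tm).sub ?_).norm
    have : Tendsto (fun y : ℝ => I * ((2 * y : ℝ) • (ℓ - G w₀))) (𝓝[<] π)
        (𝓝 (I * ((2 * π : ℝ) • (ℓ - G w₀)))) :=
      Tendsto.mono_left (Continuous.tendsto (by fun_prop) π) nhdsWithin_le_nhds
    convert this using 2
    simp
    ring
  have hle : ‖(∫ u in (-R)..R, (gp u - gm u) * (Real.exp u / (Real.exp u + cexp w₀))) -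
        2 * π * I * (ℓ - G w₀)‖ ≤ 4 * π * δ := by
    refine le_of_tendsto hlim ?_
    filter_upwards [Ioo_mem_nhdsLT hpi] with y hy
    -- The rectangle has corners `± (R + y i)`.
    have hrect := integral_boundary_rect_eq_zero_of_differentiableOn (stripKernel G w₀)
      ((-R : ℝ) + (-1 * y : ℝ) * I) ((R : ℝ) + (1 * y : ℝ) * I) (hdiff.mono ?_)
    · simp only [add_re, ofReal_re, mul_re, I_re, mul_zero, ofReal_im, I_im, mul_one, sub_self,
        add_zero, add_im, mul_im, zero_add] at hrect
      rw [show (-1 * y) = -y by ring, one_mul] at hrect ⊢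
      have k1 := norm_integral_vertical_sub_le hdiff (x := R) (L := ℓ - G w₀) (δ := δ)
        (fun t ht => by
          have := h1 (R + t * I) (by simp) (hmem R t ht)
          rw [dist_eq_norm] at this
          exact this.le) hy.1.le hy.2
      have k2 := norm_integral_vertical_sub_le hdiff (x := -R) (L := 0) (δ := δ)
        (fun t ht => by
          have := h2 ((-R : ℝ) + t * I) (by simp) (hmem (-R) t ht)
          rw [dist_eq_norm] at this
          exact this.le) hy.1.le hy.2
      rw [smul_zero, sub_zero] at k2
      set A := ∫ t in (-y)..y, stripKernel G w₀ ((R : ℝ) + t * I)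
      set A' := ∫ t in (-y)..y, stripKernel G w₀ ((-R : ℝ) + t * I)
      have hE : (∫ u in (-R)..R, stripKernel G w₀ (u + (y : ℂ) * I)) -
        (∫ u in (-R)..R, stripKernel G w₀ (u + ((-y : ℝ) : ℂ) * I)) -
          I * ((2 * y : ℝ) • (ℓ - G w₀)) = I * (A - (2 * y : ℝ) • (ℓ - G w₀)) - I * A' := by
        simp only [smul_eq_mul] at hrect
        linear_combination -hrect
      rw [hE]
      refine (norm_sub_le _ _).trans ?_
      rw [norm_mul, norm_mul, norm_I, one_mul, one_mul]
      have : δ * (2 * y) ≤ δ * (2 * π) := by gcongr; exact hy.2.le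
      linarith
    · rintro w ⟨-, hw⟩
      simp only [add_im, ofReal_im, mul_im, ofReal_re, I_im, I_re, mul_zero, add_zero, zero_add,
        mul_one, mem_preimage] at hw
      rw [uIcc_of_le (by linarith [hy.1])] at hw
      show |w.im| < π
      exact abs_lt.2 ⟨by linarith [hw.1, hy.2], by linarith [hw.2, hy.2]⟩
  rw [dist_eq_norm]
  refine hle.trans_lt ?_
  rw [hδ]
  field_simp
  linarith

end StripCauchy

/-! ### The approximants and their integral representation -/

section Approximants

open Complex Filter Topology Real Interval

/-- The `N`-th approximation to `log Γ (z + 1)`: the logarithm of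
`N! (N + z) ^ z / ∏_{n = 1}^N (n + z)`, taken factor by factor. Taking `(N + z) ^ z` where
Euler's limit formula has `N ^ z` does not change the limit in `N`, makes the quotient by
`z log z` tend to `1` at infinity, and keeps the density on the cut non-negative. -/
noncomputable def approxLogGamma (N : ℕ) (z : ℂ) : ℂ :=
  z * Complex.log ((N : ℝ) + z) -
    ∑ n ∈ Finset.range N, (Complex.log ((n + 1 : ℝ) + z) - Real.log (n + 1))

lemma approxLogGamma_one (N : ℕ) : approxLogGamma N 1 = 0 := by
  have h := Finset.sum_range_sub (fun n : ℕ => Real.log (n + 1)) N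
  have h2 : ∀ n : ℕ, Complex.log ((n + 1 : ℝ) + 1) = (Real.log ((n + 1 : ℕ) + 1) : ℝ) := by
    intro n
    rw [ofReal_log (by positivity)]
    push_cast
    rfl
  have h3 : Complex.log ((N : ℝ) + 1) = (Real.log (N + 1) : ℝ) := by
    rw [ofReal_log (by positivity)]
    push_cast
    rfl
  have h' := congrArg (fun x : ℝ => (x : ℂ)) h
  rw [approxLogGamma, h3]
  simp only [h2]
  push_cast at h' ⊢
  simp only [zero_add, Real.log_one, ofReal_zero] at h'
  linear_combination -h'

lemma ofReal_add_mem_slitPlane {a : ℝ} (ha : 0 ≤ a) {z : ℂ} (hz : z ∈ slitPlane) :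
    (a : ℂ) + z ∈ slitPlane := by
  rw [mem_slitPlane_iff] at hz ⊢
  rcases hz with h | h
  · left
    simp
    linarith
  · right
    simpa using h

lemma differentiableOn_approxLogGamma (N : ℕ) :
    DifferentiableOn ℂ (approxLogGamma N) slitPlane := by
  have h : ∀ a : ℝ, 0 ≤ a → DifferentiableOn ℂ (fun z => Complex.log ((a : ℂ) + z)) slitPlane :=
    fun a ha => DifferentiableOn.clog (by fun_prop) fun z hz => ofReal_add_mem_slitPlane ha hz
  refine DifferentiableOn.sub (differentiableOn_id.mul (h N (by positivity))) ?_
  refine DifferentiableOn.fun_sum fun n _ => DifferentiableOn.sub ?_ (by fun_prop)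
  exact_mod_cast h (n + 1) (by positivity)

lemma exp_mem_slitPlane_of_mem_strip {w : ℂ} (hw : w ∈ principalStrip) : cexp w ∈ slitPlane := by
  have h := abs_lt.1 (show |w.im| < π from hw)
  rw [mem_slitPlane_iff_arg]
  refine ⟨?_, Complex.exp_ne_zero w⟩
  rw [← log_im, Complex.log_exp h.1 h.2.le]
  exact h.2.ne

/-- The quotient `approxLogGamma N z / (z log z)` in the coordinate `z = e ^ w`, continued
across `w = 0`. -/
noncomputable def stripQuotient (N : ℕ) : ℂ → ℂ :=
  dslope (fun w => approxLogGamma N (cexp w) / cexp w) 0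

lemma stripQuotient_of_ne (N : ℕ) {w : ℂ} (hw : w ≠ 0) :
    stripQuotient N w = approxLogGamma N (cexp w) / (cexp w * w) := by
  rw [stripQuotient, dslope_of_ne _ hw, slope_def_field]
  simp [approxLogGamma_one, div_div]

lemma differentiableOn_stripQuotient (N : ℕ) :
    DifferentiableOn ℂ (stripQuotient N) principalStrip := by
  refine (differentiableOn_dslope (isOpen_principalStrip.mem_nhds ?_)).2 ?_
  · show |_| < π
    simp [Real.pi_pos]
  · refine DifferentiableOn.div ?_ differentiable_exp.differentiableOn
      fun w _ => Complex.exp_ne_zero w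
    exact (differentiableOn_approxLogGamma N).comp differentiable_exp.differentiableOn
      fun w hw => exp_mem_slitPlane_of_mem_strip hw

/-! ### Behaviour at the two ends of the strip -/

lemma tendsto_inv_comap_re_atTop : Tendsto (fun w : ℂ => w⁻¹) (comap re atTop) (𝓝 0) := by
  refine tendsto_inv₀_cobounded.comp ?_
  rw [← tendsto_norm_atTop_iff_cobounded]
  exact tendsto_atTop_mono (fun w => (le_abs_self _).trans (abs_re_le_norm w)) tendsto_comap

lemma tendsto_inv_comap_re_atBot : Tendsto (fun w : ℂ => w⁻¹) (comap re atBot) (𝓝 0) := by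
  refine tendsto_inv₀_cobounded.comp ?_
  rw [← tendsto_norm_atTop_iff_cobounded]
  exact tendsto_atTop_mono (fun w => (neg_le_abs _).trans (abs_re_le_norm w))
    (tendsto_neg_atBot_atTop.comp tendsto_comap)

/-- The bound `8` covers `log 2 ≤ 1` for the real part and `2 π ≤ 7` for the imaginary part. -/
lemma norm_log_add_exp_sub_le {a : ℝ} (ha : 0 ≤ a) {w : ℂ} (hw : |w.im| < π)
    (h : 2 * a ≤ Real.exp w.re) : ‖Complex.log (a + cexp w) - w‖ ≤ 8 := by
  have hlo : Real.exp w.re / 2 ≤ ‖(a : ℂ) + cexp w‖ := by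
    have h1 := norm_sub_norm_le (cexp w) (-(a : ℂ))
    rw [norm_neg, norm_real, Real.norm_of_nonneg ha, Complex.norm_exp, sub_neg_eq_add, add_comm] at h1
    rw [add_comm] at h1 ⊢
    linarith
  have hhi : ‖(a : ℂ) + cexp w‖ ≤ Real.exp w.re * 2 := by
    have h1 := norm_add_le (a : ℂ) (cexp w)
    rw [norm_real, Real.norm_of_nonneg ha, Complex.norm_exp] at h1
    linarith [Real.exp_pos w.re]
  have hpos := Real.exp_pos w.re
  have hre : |(Complex.log (a + cexp w) - w).re| ≤ 1 := by
    rw [sub_re, log_re]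
    have h2 : Real.log 2 ≤ 1 := by linarith [Real.log_two_lt_d9]
    have l1 := Real.log_le_log (by positivity) hlo
    have l2 := Real.log_le_log (by linarith) hhi
    rw [Real.log_div hpos.ne' two_ne_zero, Real.log_exp] at l1
    rw [Real.log_mul hpos.ne' two_ne_zero, Real.log_exp] at l2
    exact abs_le.2 ⟨by linarith, by linarith⟩
  have him : |(Complex.log (a + cexp w) - w).im| ≤ 7 := by
    rw [sub_im]
    have h2 : |(Complex.log (a + cexp w)).im| ≤ π := by
      rw [log_im]
      exact abs_arg_le_pi _
    have := abs_sub (Complex.log (a + cexp w)).im w.im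
    linarith [Real.pi_lt_d2]
  exact (norm_le_abs_re_add_abs_im _).trans (by linarith)

lemma tendsto_log_add_exp_mul_inv {a : ℝ} (ha : 0 ≤ a) :
    Tendsto (fun w => Complex.log (a + cexp w) * w⁻¹) (comap re atTop ⊓ 𝓟 principalStrip)
      (𝓝 1) := by
  have hinv := tendsto_inv_comap_re_atTop.mono_left
    (inf_le_left : comap re atTop ⊓ 𝓟 principalStrip ≤ _)
  have h0 : Tendsto (fun w => (Complex.log (a + cexp w) - w) * w⁻¹)
      (comap re atTop ⊓ 𝓟 principalStrip) (𝓝 0) := by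
    refine squeeze_zero_norm' (a := fun w : ℂ => 8 * ‖w⁻¹‖) ?_ ?_
    · rw [eventually_inf_principal]
      filter_upwards [tendsto_comap.eventually
        (Real.tendsto_exp_atTop.eventually (eventually_ge_atTop (2 * a)))] with w hw hs
      rw [norm_mul]
      gcongr
      exact norm_log_add_exp_sub_le ha hs hw
    · simpa using hinv.norm.const_mul 8
  have h1 := h0.add_const 1
  rw [zero_add] at h1
  refine h1.congr' ?_
  have hev : ∀ᶠ w : ℂ in comap re atTop ⊓ 𝓟 principalStrip, 0 < w.re :=
    (tendsto_comap.eventually (eventually_gt_atTop 0)).filter_mono inf_le_left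
  filter_upwards [hev] with w hw
  have : w ≠ 0 := by
    rintro rfl
    simp at hw
  field_simp
  ring

lemma tendsto_stripQuotient_right (N : ℕ) :
    Tendsto (stripQuotient N) (comap re atTop ⊓ 𝓟 principalStrip) (𝓝 1) := by
  have hinv := tendsto_inv_comap_re_atTop.mono_left
    (inf_le_left : comap re atTop ⊓ 𝓟 principalStrip ≤ _)
  have hexp : Tendsto (fun w => (cexp w)⁻¹) (comap re atTop ⊓ 𝓟 principalStrip) (𝓝 0) :=
    tendsto_inv₀_cobounded.comp (Tendsto.mono_left
      (show Tendsto cexp (comap re atTop) _ from map_exp_comap_re_atTop.le) inf_le_left)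
  have hN := tendsto_log_add_exp_mul_inv (a := N) (by positivity)
  have hs : Tendsto (fun w => ∑ n ∈ Finset.range N,
      (Complex.log ((n + 1 : ℝ) + cexp w) * w⁻¹ - Real.log (n + 1) * w⁻¹) * (cexp w)⁻¹)
      (comap re atTop ⊓ 𝓟 principalStrip)
      (𝓝 (∑ n ∈ Finset.range N, (1 - Real.log (n + 1) * 0) * 0)) :=
    tendsto_finsetSum _ fun n _ => ((tendsto_log_add_exp_mul_inv (by positivity)).sub
      (hinv.const_mul _)).mul hexp
  have h := hN.sub hs
  simp only [mul_zero, Finset.sum_const_zero, sub_zero] at h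
  refine h.congr' ?_
  have hev : ∀ᶠ w : ℂ in comap re atTop ⊓ 𝓟 principalStrip, 0 < w.re :=
    (tendsto_comap.eventually (eventually_gt_atTop 0)).filter_mono inf_le_left
  filter_upwards [hev] with w hw
  have hw0 : w ≠ 0 := by
    rintro rfl
    simp at hw
  have := Complex.exp_ne_zero w
  rw [stripQuotient_of_ne N hw0, approxLogGamma, sub_div, Finset.sum_div]
  congr 1
  · field_simp
  · refine Finset.sum_congr rfl fun n _ => ?_
    field_simp

lemma tendsto_stripQuotient_left {N : ℕ} (hN : 0 < N) :
    Tendsto (fun w => cexp w * stripQuotient N w) (comap re atBot ⊓ 𝓟 principalStrip) (𝓝 0) := by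
  refine Tendsto.mono_left ?_ inf_le_left
  have hlog : ∀ a : ℝ, 0 < a →
      Tendsto (fun w => Complex.log (a + cexp w)) (comap re atBot) (𝓝 (Real.log a)) := by
    intro a ha
    rw [ofReal_log ha.le]
    have h1 : Tendsto (fun w => (a : ℂ) + cexp w) (comap re atBot) (𝓝 a) := by
      simpa using tendsto_exp_comap_re_atBot.const_add (a : ℂ)
    exact h1.clog (Or.inl (by simpa using ha))
  have hM : Tendsto (fun w => approxLogGamma N (cexp w)) (comap re atBot) (𝓝 0) := by
    have h := (tendsto_exp_comap_re_atBot.mul (hlog N (by positivity))).sub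
      (tendsto_finsetSum (Finset.range N) fun n _ =>
        (hlog (n + 1) (by positivity)).sub_const (Real.log (n + 1) : ℂ))
    simpa [approxLogGamma] using h
  have h := hM.mul tendsto_inv_comap_re_atBot
  rw [mul_zero] at h
  refine h.congr' ?_
  filter_upwards [tendsto_comap.eventually (eventually_lt_atBot 0)] with w hw
  have hw0 : w ≠ 0 := by
    rintro rfl
    simp at hw
  have := Complex.exp_ne_zero w
  rw [stripQuotient_of_ne N hw0]
  field_simp

/-! ### Boundary values on the cut -/

/-- The boundary value of `log (a + z)` at `z = -t`, from above for `s = 1` and from below for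
`s = -1`. -/
noncomputable def edgeLog (s a t : ℝ) : ℂ :=
  Real.log |a - t| + (if a < t then s * π else 0 : ℝ) * I

lemma tendsto_exp_edge {s : ℝ} (hs : s = 1 ∨ s = -1) (u : ℝ) :
    Tendsto (fun y : ℝ => cexp (u + ((s * y : ℝ) : ℂ) * I)) (𝓝[<] π)
      (𝓝 (-(Real.exp u : ℂ))) := by
  have hexp : cexp (u + ((s * π : ℝ) : ℂ) * I) = -Real.exp u := by
    rw [Complex.exp_add]
    rcases hs with h | h <;> subst h <;> simp [Complex.exp_neg]
  rw [← hexp]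
  exact Tendsto.mono_left (Continuous.tendsto (by fun_prop) π) nhdsWithin_le_nhds

lemma tendsto_log_edge {s : ℝ} (hs : s = 1 ∨ s = -1) {a u : ℝ} (ha : a ≠ Real.exp u) :
    Tendsto (fun y : ℝ => Complex.log (a + cexp (u + ((s * y : ℝ) : ℂ) * I))) (𝓝[<] π)
      (𝓝 (edgeLog s a (Real.exp u))) := by
  have h1 := (tendsto_exp_edge hs u).const_add (a : ℂ)
  rw [← sub_eq_add_neg, ← ofReal_sub] at h1
  rcases lt_or_gt_of_ne ha with h | h
  · have him : ∀ y : ℝ, ((a : ℂ) + cexp (u + ((s * y : ℝ) : ℂ) * I)).im =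
        Real.exp u * Real.sin (s * y) := by
      intro y
      rw [add_im, ofReal_im, zero_add, exp_im]
      simp
    have hnorm : ‖((a - Real.exp u : ℝ) : ℂ)‖ = |a - Real.exp u| := by
      rw [norm_real, Real.norm_eq_abs]
    have hev : ∀ᶠ y : ℝ in 𝓝[<] π, 0 < Real.sin y := by
      filter_upwards [Ioo_mem_nhdsLT Real.pi_pos] with y hy using Real.sin_pos_of_mem_Ioo hy
    rcases hs with rfl | rfl
    · have h2 := tendsto_log_nhdsWithin_im_nonneg_of_re_neg_of_im_zero
        (z := ((a - Real.exp u : ℝ) : ℂ)) (by rw [ofReal_re]; linarith) (by simp)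
      rw [hnorm] at h2
      rw [edgeLog, if_pos h, one_mul]
      refine h2.comp (tendsto_nhdsWithin_iff.2 ⟨h1, ?_⟩)
      filter_upwards [hev] with y hy
      show 0 ≤ _
      rw [him, one_mul]
      positivity
    · have h2 := tendsto_log_nhdsWithin_im_neg_of_re_neg_of_im_zero
        (z := ((a - Real.exp u : ℝ) : ℂ)) (by rw [ofReal_re]; linarith) (by simp)
      rw [hnorm] at h2
      have h3 : edgeLog (-1) a (Real.exp u) = Real.log |a - Real.exp u| - π * I := by
        rw [edgeLog, if_pos h]
        push_cast
        ring
      rw [h3]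
      refine h2.comp (tendsto_nhdsWithin_iff.2 ⟨h1, ?_⟩)
      filter_upwards [hev] with y hy
      show _ < 0
      rw [him, neg_one_mul, Real.sin_neg]
      have := Real.exp_pos u
      nlinarith
  · have h2 := h1.clog (Or.inl (by rw [ofReal_re]; linarith))
    rw [edgeLog, if_neg h.le.not_gt, abs_of_pos (by linarith)]
    rw [ofReal_log (by linarith)]
    simpa using h2

/-- The boundary values of `stripQuotient N`. -/
noncomputable def edgeQuotient (N : ℕ) (s u : ℝ) : ℂ :=
  (-(Real.exp u : ℂ) * edgeLog s N (Real.exp u) -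
    ∑ n ∈ Finset.range N, (edgeLog s (n + 1) (Real.exp u) - Real.log (n + 1))) /
    (-(Real.exp u : ℂ) * (u + ((s * π : ℝ) : ℂ) * I))

lemma add_mul_I_ne_zero {u y : ℝ} (hy : y ≠ 0) : (u + (y : ℂ) * I) ≠ 0 := by
  intro h
  have := congrArg Complex.im h
  simp at this
  exact hy this

lemma tendsto_stripQuotient_edge (N : ℕ) {s : ℝ} (hs : s = 1 ∨ s = -1) {u : ℝ}
    (hu : ∀ n : ℕ, (n : ℝ) ≠ Real.exp u) :
    Tendsto (fun y : ℝ => stripQuotient N (u + ((s * y : ℝ) : ℂ) * I)) (𝓝[<] π)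
      (𝓝 (edgeQuotient N s u)) := by
  have hs0 : s ≠ 0 := by rcases hs with rfl | rfl <;> norm_num
  have hw : Tendsto (fun y : ℝ => (u + ((s * y : ℝ) : ℂ) * I)) (𝓝[<] π)
      (𝓝 (u + ((s * π : ℝ) : ℂ) * I)) :=
    Tendsto.mono_left (Continuous.tendsto (by fun_prop) π) nhdsWithin_le_nhds
  have hM : Tendsto (fun y : ℝ => approxLogGamma N (cexp (u + ((s * y : ℝ) : ℂ) * I))) (𝓝[<] π)
      (𝓝 (-(Real.exp u : ℂ) * edgeLog s N (Real.exp u) -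
    ∑ n ∈ Finset.range N, (edgeLog s (n + 1) (Real.exp u) - Real.log (n + 1)))) := by
    refine ((tendsto_exp_edge hs u).mul (tendsto_log_edge hs (hu N))).sub
      (tendsto_finsetSum _ fun n _ => (tendsto_log_edge hs ?_).sub_const _)
    exact_mod_cast hu (n + 1)
  have h := hM.div ((tendsto_exp_edge hs u).mul hw) (by
    refine mul_ne_zero (neg_ne_zero.2 (by exact_mod_cast (Real.exp_pos u).ne')) ?_
    exact add_mul_I_ne_zero (mul_ne_zero hs0 Real.pi_pos.ne'))
  refine h.congr' ?_
  filter_upwards [Ioo_mem_nhdsLT Real.pi_pos] with y hy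
  rw [stripQuotient_of_ne N (add_mul_I_ne_zero (mul_ne_zero hs0 hy.1.ne'))]
  rfl

/-! ### The approximating density -/

/-- The imaginary part of `log (a + z) * conj (log z)` at `z = -t + i0`, divided by `π`. -/
noncomputable def logKernel (a t : ℝ) : ℝ :=
  (if a < t then Real.log t else 0) - Real.log |a - t|

/-- The numerator of `approxDensity`: `-1 / π` times the imaginary part of
`approxLogGamma N z * conj (log z)` at `z = -t + i0`. -/
noncomputable def approxNumer (N : ℕ) (t : ℝ) : ℝ :=
  t * logKernel N t + ∑ n ∈ Finset.range N, (logKernel (n + 1) t + Real.log (n + 1))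

/-- The function `δ` of `t > 0` with
`approxLogGamma N z / (z log z) = 1 - ∫ t in (0, ∞), δ t / (t + z)`. It is `1 / π` times the
imaginary part of the left-hand side at `z = -t + i0`. -/
noncomputable def approxDensity (N : ℕ) (t : ℝ) : ℝ :=
  approxNumer N t / (t * (Real.log t ^ 2 + π ^ 2))

lemma log_sq_add_pi_sq_pos (t : ℝ) : 0 < Real.log t ^ 2 + π ^ 2 := by
  have := Real.pi_pos
  positivity

lemma edgeQuotient_sub (N : ℕ) (u : ℝ) :
    edgeQuotient N 1 u - edgeQuotient N (-1) u = 2 * π * I * approxDensity N (Real.exp u) := by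
  have ht : (Real.exp u : ℂ) ≠ 0 := by exact_mod_cast (Real.exp_pos u).ne'
  have hD : ((u : ℂ) ^ 2 + π ^ 2) ≠ 0 := by
    have := log_sq_add_pi_sq_pos (Real.exp u)
    rw [Real.log_exp] at this
    exact_mod_cast this.ne'
  have h1 : (u + ((1 * π : ℝ) : ℂ) * I) ≠ 0 := add_mul_I_ne_zero (by simp [Real.pi_ne_zero])
  have h2 : (u + ((-1 * π : ℝ) : ℂ) * I) ≠ 0 := add_mul_I_ne_zero (by simp [Real.pi_ne_zero])
  have key : ∀ a : ℝ, edgeLog 1 a (Real.exp u) * (u + ((-1 * π : ℝ) : ℂ) * I) -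
      edgeLog (-1) a (Real.exp u) * (u + ((1 * π : ℝ) : ℂ) * I) =
      2 * π * I * logKernel a (Real.exp u) := by
    intro a
    rw [edgeLog, edgeLog, logKernel, Real.log_exp]
    split_ifs
    · push_cast
      ring
    · push_cast
      ring
  have key2 : ∀ c : ℝ, (c : ℂ) * (u + ((-1 * π : ℝ) : ℂ) * I) -
      c * (u + ((1 * π : ℝ) : ℂ) * I) = - (2 * π * I * c) := by
    intro c
    push_cast
    ring
  have hprod : (u + ((1 * π : ℝ) : ℂ) * I) * (u + ((-1 * π : ℝ) : ℂ) * I) = (u : ℂ) ^ 2 + π ^ 2 := by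
    push_cast
    linear_combination (-(π : ℂ) ^ 2) * I_sq
  have hsum : (∑ n ∈ Finset.range N, (edgeLog 1 (n + 1) (Real.exp u) - Real.log (n + 1))) *
      (u + ((-1 * π : ℝ) : ℂ) * I) -
      (∑ n ∈ Finset.range N, (edgeLog (-1) (n + 1) (Real.exp u) - Real.log (n + 1))) *
      (u + ((1 * π : ℝ) : ℂ) * I) = 2 * π * I *
      (∑ n ∈ Finset.range N, (logKernel (n + 1) (Real.exp u) + Real.log (n + 1)) : ℝ) := by
    rw [Finset.sum_mul, Finset.sum_mul, ← Finset.sum_sub_distrib, ofReal_sum, Finset.mul_sum]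
    refine Finset.sum_congr rfl fun n _ => ?_
    have a1 := key (n + 1)
    have a2 := key2 (Real.log (n + 1))
    push_cast at a1 a2 ⊢
    linear_combination a1 - a2
  rw [edgeQuotient, edgeQuotient, div_sub_div _ _ (mul_ne_zero (neg_ne_zero.2 ht) h1)
    (mul_ne_zero (neg_ne_zero.2 ht) h2), approxDensity, approxNumer, Real.log_exp]
  have hden : -(Real.exp u : ℂ) * (u + ((1 * π : ℝ) : ℂ) * I) *
      (-(Real.exp u : ℂ) * (u + ((-1 * π : ℝ) : ℂ) * I)) =
      (Real.exp u : ℂ) ^ 2 * ((u : ℂ) ^ 2 + π ^ 2) := by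
    rw [← hprod]
    ring
  rw [hden, div_eq_iff (mul_ne_zero (pow_ne_zero 2 ht) hD)]
  have hR : (2 * π * I * (((Real.exp u * logKernel N (Real.exp u) +
      ∑ n ∈ Finset.range N, (logKernel (n + 1) (Real.exp u) + Real.log (n + 1))) /
      (Real.exp u * (u ^ 2 + π ^ 2)) : ℝ) : ℂ)) * ((Real.exp u : ℂ) ^ 2 * ((u : ℂ) ^ 2 + π ^ 2)) =
      2 * π * I * (Real.exp u * (Real.exp u * logKernel N (Real.exp u) +
      (∑ n ∈ Finset.range N, (logKernel (n + 1) (Real.exp u) + Real.log (n + 1)) : ℝ))) := by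
    rw [ofReal_div, ofReal_add, ofReal_mul, ofReal_mul, ofReal_add, ofReal_pow, ofReal_pow]
    field_simp
  rw [hR]
  have kN := key N
  linear_combination (Real.exp u : ℂ) ^ 2 * kN + (Real.exp u : ℂ) * hsum

/-! ### Domination near the cut -/

lemma norm_log_add_le {a t : ℝ} (ha : 0 ≤ a) {z : ℂ} (hz : ‖z‖ = t) (hat : a ≠ t) :
    ‖Complex.log (a + z)‖ ≤ |Real.log (|a - t|)| + |Real.log (a + t)| + π := by
  have hlo : |a - t| ≤ ‖(a : ℂ) + z‖ := by
    have h1 := abs_norm_sub_norm_le (a : ℂ) (-z)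
    rwa [norm_neg, hz, norm_real, Real.norm_of_nonneg ha, sub_neg_eq_add] at h1
  have hhi : ‖(a : ℂ) + z‖ ≤ a + t := by
    have h1 := norm_add_le (a : ℂ) z
    rwa [norm_real, Real.norm_of_nonneg ha, hz] at h1
  have h0 : 0 < |a - t| := abs_pos.2 (sub_ne_zero.2 hat)
  refine (norm_le_abs_re_add_abs_im _).trans (add_le_add ?_ ?_)
  · rw [log_re]
    have l1 := Real.log_le_log h0 hlo
    have l2 := Real.log_le_log (h0.trans_le hlo) hhi
    refine abs_le.2 ⟨?_, ?_⟩
    · linarith [neg_abs_le (Real.log |a - t|), abs_nonneg (Real.log (a + t))]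
    · linarith [le_abs_self (Real.log (a + t)), abs_nonneg (Real.log |a - t|)]
  · rw [log_im]
    exact abs_arg_le_pi _

/-- The majorant of `log (a + z)` on the circle `|z| = e ^ u`. -/
noncomputable def logMajorant (a u : ℝ) : ℝ :=
  |Real.log (|a - Real.exp u|)| + |Real.log (a + Real.exp u)| + π

/-- The majorant of `stripQuotient N` near the edges of the strip. -/
noncomputable def quotientMajorant (N : ℕ) (u : ℝ) : ℝ :=
  logMajorant N u +
    ∑ n ∈ Finset.range N, (logMajorant (n + 1) u + |Real.log (n + 1)|) * Real.exp (-u)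

lemma intervalIntegrable_logMajorant {a : ℝ} (ha : 0 ≤ a) (x y : ℝ) :
    IntervalIntegrable (logMajorant a) volume x y := by
  have h1 : IntervalIntegrable (fun u => Real.log ‖a - Real.exp u‖) volume x y :=
    MeromorphicOn.intervalIntegrable_log_norm fun u _ => by fun_prop
  have h2 : Continuous fun u => Real.log (a + Real.exp u) :=
    Continuous.log (by fun_prop) fun u => by positivity
  exact (h1.abs.add (h2.abs.intervalIntegrable _ _)).add (intervalIntegrable_const (c := π))

lemma intervalIntegrable_quotientMajorant (N : ℕ) (x y : ℝ) :
    IntervalIntegrable (quotientMajorant N) volume x y := by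
  refine (intervalIntegrable_logMajorant (by positivity) x y).add ?_
  have := IntervalIntegrable.sum (Finset.range N) (μ := volume) (a := x) (b := y)
    (f := fun n u => (logMajorant (n + 1) u + |Real.log (n + 1)|) * Real.exp (-u)) fun n _ =>
      (((intervalIntegrable_logMajorant (by positivity) x y).add
        intervalIntegrable_const).mul_continuousOn (by fun_prop))
  refine this.congr fun u _ => ?_
  simp

lemma norm_stripQuotient_le (N : ℕ) {u y : ℝ} (hu : ∀ n : ℕ, (n : ℝ) ≠ Real.exp u)
    (hy : π / 2 ≤ |y|) : ‖stripQuotient N (u + y * I)‖ ≤ quotientMajorant N u := by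
  have hy1 : 1 ≤ |y| := by linarith [Real.pi_gt_three]
  have hy0 : y ≠ 0 := by
    rintro rfl
    simp at hy1
    linarith
  have hz : ‖cexp (u + y * I)‖ = Real.exp u := by
    rw [Complex.norm_exp]
    simp
  have hw : 1 ≤ ‖(u + y * I : ℂ)‖ := by
    refine hy1.trans ?_
    simpa using abs_im_le_norm (u + y * I : ℂ)
  have hpos := Real.exp_pos u
  rw [stripQuotient_of_ne N (add_mul_I_ne_zero hy0), norm_div, norm_mul, hz]
  have hM : ‖approxLogGamma N (cexp (u + y * I))‖ ≤ Real.exp u * logMajorant N u +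
      ∑ n ∈ Finset.range N, (logMajorant (n + 1) u + |Real.log (n + 1)|) := by
    refine (norm_sub_le _ _).trans (add_le_add ?_ ?_)
    · rw [norm_mul, hz]
      gcongr
      exact norm_log_add_le (by positivity) hz (hu N)
    · refine (norm_sum_le _ _).trans (Finset.sum_le_sum fun n _ => ?_)
      refine (norm_sub_le _ _).trans (add_le_add ?_ ?_)
      · exact norm_log_add_le (by positivity) hz (by exact_mod_cast hu (n + 1))
      · rw [norm_real, Real.norm_eq_abs]
  calc ‖approxLogGamma N (cexp (u + y * I))‖ / (Real.exp u * ‖(u + y * I : ℂ)‖)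
      ≤ ‖approxLogGamma N (cexp (u + y * I))‖ / (Real.exp u * 1) := by gcongr
    _ ≤ (Real.exp u * logMajorant N u +
      ∑ n ∈ Finset.range N, (logMajorant (n + 1) u + |Real.log (n + 1)|)) / (Real.exp u * 1) := by
        gcongr
    _ = quotientMajorant N u := by
        rw [mul_one, add_div, quotientMajorant, mul_div_cancel_left₀ _ hpos.ne', ← Finset.sum_mul,
          Real.exp_neg, div_eq_mul_inv]

lemma ae_forall_natCast_ne : ∀ᵐ t : ℝ, ∀ n : ℕ, (n : ℝ) ≠ t := by
  rw [ae_all_iff]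
  intro n
  refine (measure_eq_zero_iff_ae_notMem.1 (measure_singleton (n : ℝ))).mono fun t ht h => ht h.symm

lemma ae_forall_natCast_ne_exp : ∀ᵐ u : ℝ, ∀ n : ℕ, (n : ℝ) ≠ Real.exp u := by
  rw [ae_all_iff]
  intro n
  refine (measure_eq_zero_iff_ae_notMem.1 (measure_singleton (Real.log n))).mono fun u hu h => hu ?_
  show u = Real.log n
  rw [h, Real.log_exp]

lemma integral_comp_exp_mul_exp (g : ℝ → ℂ) {R : ℝ} (hR : 0 ≤ R) :
    ∫ u in (-R)..R, Real.exp u • g (Real.exp u) =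
      ∫ t in Ioc (Real.exp (-R)) (Real.exp R), g t := by
  have himg : Real.exp '' Ioc (-R) R = Ioc (Real.exp (-R)) (Real.exp R) := by
    ext t
    constructor
    · rintro ⟨u, hu, rfl⟩
      exact ⟨Real.exp_lt_exp.2 hu.1, Real.exp_le_exp.2 hu.2⟩
    · rintro ⟨h1, h2⟩
      have ht := (Real.exp_pos _).trans h1
      exact ⟨Real.log t, ⟨(Real.lt_log_iff_exp_lt ht).2 h1, (Real.log_le_iff_le_exp ht).2 h2⟩,
        Real.exp_log ht⟩
  rw [intervalIntegral.integral_of_le (by linarith), ← himg,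
    integral_image_eq_integral_abs_deriv_smul measurableSet_Ioc
      (fun u _ => (Real.hasDerivAt_exp u).hasDerivWithinAt) Real.exp_injective.injOn]
  simp [abs_of_pos (Real.exp_pos _)]

/-- The representation of `approxLogGamma N z / (z log z)` by its density, as a limit over
intervals exhausting `(0, ∞)`. -/
theorem tendsto_integral_approxDensity {N : ℕ} (hN : 0 < N) {z : ℂ} (hz : z ∈ slitPlane)
    (hz1 : z ≠ 1) :
    Tendsto (fun R : ℝ => ∫ t in Ioc (Real.exp (-R)) (Real.exp R),
      (approxDensity N t : ℂ) / (t + z)) atTop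
      (𝓝 (1 - approxLogGamma N z / (z * Complex.log z))) := by
  have hz0 := slitPlane_ne_zero hz
  have hw : Complex.log z ∈ principalStrip := by
    show |_| < π
    rw [log_im, abs_lt]
    exact ⟨neg_pi_lt_arg z, lt_of_le_of_ne (arg_le_pi z) (mem_slitPlane_iff_arg.1 hz).1⟩
  have hw0 : Complex.log z ≠ 0 := by
    intro h
    have := Complex.exp_log hz0
    rw [h, Complex.exp_zero] at this
    exact hz1 this.symm
  have h := tendsto_integral_strip_jump (differentiableOn_stripQuotient N) hw
    (fun R => intervalIntegrable_quotientMajorant N (-R) R)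
    (ae_forall_natCast_ne_exp.mono fun u hu y h1 _ => norm_stripQuotient_le N hu h1)
    (ae_forall_natCast_ne_exp.mono fun u hu => tendsto_stripQuotient_edge N (Or.inl rfl) hu)
    (ae_forall_natCast_ne_exp.mono fun u hu => tendsto_stripQuotient_edge N (Or.inr rfl) hu)
    (tendsto_stripQuotient_right N) (tendsto_stripQuotient_left hN)
  rw [stripQuotient_of_ne N hw0, Complex.exp_log hz0] at h
  have h2pi : (2 * π * I : ℂ) ≠ 0 := two_pi_I_ne_zero
  have h' := h.const_mul (2 * π * I : ℂ)⁻¹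
  rw [inv_mul_cancel_left₀ h2pi] at h'
  refine h'.congr' ?_
  filter_upwards [eventually_ge_atTop 0] with R hR
  rw [← integral_comp_exp_mul_exp _ hR, ← intervalIntegral.integral_const_mul]
  congr 1
  ext u
  rw [edgeQuotient_sub, real_smul]
  field_simp

end Approximants

/-! ### The density and its approximations -/

section Density

open Filter Topology Real

/-- The numerator of the density at `-t` for non-integral `t > 0`. -/
noncomputable def densityNumer (t : ℝ) : ℝ :=
  Real.log |Real.Gamma (1 - t)| + ⌊t⌋₊ * Real.log t

/-- The density at `-t` for non-integral `t > 0`, as a real number. Its values at the integers,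
where `pickDensity (-t)` is infinite, are irrelevant: they form a null set. -/
noncomputable def density (t : ℝ) : ℝ :=
  densityNumer t / (t * (Real.log t ^ 2 + π ^ 2))

lemma floor_lt_of_forall_ne {t : ℝ} (ht : 0 < t) (hn : ∀ n : ℕ, (n : ℝ) ≠ t) :
    (⌊t⌋₊ : ℝ) < t :=
  lt_of_le_of_ne (Nat.floor_le ht.le) (hn _)

lemma pickDensityOn_neg {t : ℝ} (ht : 0 < t) (hn : ∀ n : ℕ, (n : ℝ) ≠ t) :
    pickDensityOn ⌈t⌉₊ (-t) = density t := by
  have hc : ⌈t⌉₊ = ⌊t⌋₊ + 1 := by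
    rw [Nat.ceil_eq_iff (Nat.succ_ne_zero _)]
    refine ⟨?_, ?_⟩
    · simpa using floor_lt_of_forall_ne ht hn
    · exact_mod_cast (Nat.lt_floor_add_one t).le
  rw [pickDensityOn, density, densityNumer, hc, abs_neg, abs_of_pos ht,
    show -t + 1 = 1 - t by ring]
  push_cast
  rw [neg_mul, neg_div_neg_eq]
  ring_nf

lemma pickDensity_neg {t : ℝ} (ht : 0 < t) (hn : ∀ n : ℕ, (n : ℝ) ≠ t) :
    pickDensity (-t) = (density t : ℝ) := by
  rw [pickDensity, if_neg (by linarith), if_neg, neg_neg, pickDensityOn_neg ht hn]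
  rintro ⟨k, hk⟩
  exact hn k (neg_injective hk).symm

/-- Convexity of `log Γ`, evaluated at `1` between `s` and `2`, where `Γ 1 = Γ 2 = 1`. -/
lemma log_Gamma_nonneg_of_lt_one {s : ℝ} (hs : 0 < s) (hs1 : s < 1) :
    0 ≤ Real.log (Real.Gamma s) := by
  have h := Real.convexOn_log_Gamma.2 (mem_Ioi.2 hs) (mem_Ioi.2 (two_pos : (0 : ℝ) < 2))
    (show 0 ≤ 1 / (2 - s) by apply div_nonneg <;> linarith)
    (show 0 ≤ (1 - s) / (2 - s) by apply div_nonneg <;> linarith) (by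
      have : 2 - s ≠ 0 := by linarith
      field_simp
      ring)
  have h1 : (1 / (2 - s)) • s + ((1 - s) / (2 - s)) • (2 : ℝ) = 1 := by
    have : (2 - s) ≠ 0 := by linarith
    simp only [smul_eq_mul]
    field_simp
    ring
  rw [h1] at h
  simp only [Function.comp_apply, Real.Gamma_one, Real.log_one, Real.Gamma_two, smul_eq_mul,
    mul_zero, add_zero] at h
  exact nonneg_of_mul_nonneg_right h (by apply div_pos <;> linarith)

/-- By the functional equation, passing from `t - 1` to `t` increases the numerator. -/
lemma densityNumer_nonneg {t : ℝ} (ht : 0 < t) (hn : ∀ n : ℕ, (n : ℝ) ≠ t) :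
    0 ≤ densityNumer t := by
  obtain ⟨m, hm⟩ : ∃ m : ℕ, ⌊t⌋₊ = m := ⟨_, rfl⟩
  induction m generalizing t with
  | zero =>
    have h1 : t < 1 := Nat.floor_eq_zero.1 hm
    rw [densityNumer, hm, abs_of_pos (Real.Gamma_pos_of_pos (by linarith))]
    simpa using log_Gamma_nonneg_of_lt_one (s := 1 - t) (by linarith) (by linarith)
  | succ m ih =>
    have h1 : 1 < t := by
      have := floor_lt_of_forall_ne ht hn
      rw [hm] at this
      push_cast at this
      have : (0 : ℝ) ≤ m := by positivity
      linarith
    have hfl : ⌊t - 1⌋₊ = m := by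
      rw [Nat.floor_sub_one, hm]
      rfl
    have h2 := ih (t := t - 1) (by linarith)
      (fun n h => hn (n + 1) (by push_cast; linarith)) hfl
    have hne : 1 - t ≠ 0 := by linarith
    have hne0 : Real.Gamma (1 - t) ≠ 0 := by
      refine Real.Gamma_ne_zero fun k hk => ?_
      exact hn (k + 1) (by push_cast; linarith)
    have hrec := Real.Gamma_add_one hne
    have hrec' : Real.log |Real.Gamma (1 - (t - 1))| =
        Real.log (t - 1) + Real.log |Real.Gamma (1 - t)| := by
      rw [show 1 - (t - 1) = 1 - t + 1 by ring, hrec, abs_mul,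
        Real.log_mul (abs_ne_zero.2 hne) (abs_ne_zero.2 hne0), abs_sub_comm, abs_of_pos (by linarith)]
    have hl := Real.log_le_log (x := t - 1) (y := t) (by linarith) (by linarith)
    rw [densityNumer, hfl, hrec'] at h2
    rw [densityNumer, hm]
    push_cast
    have h3 : (0 : ℝ) ≤ m := by positivity
    nlinarith

lemma density_nonneg {t : ℝ} (ht : 0 < t) (hn : ∀ n : ℕ, (n : ℝ) ≠ t) : 0 ≤ density t :=
  div_nonneg (densityNumer_nonneg ht hn) (mul_nonneg ht.le (log_sq_add_pi_sq_pos t).le)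

lemma pickDensity_nonneg (t : ℝ) : 0 ≤ pickDensity t := by
  rcases le_or_gt 0 t with h | h
  · rw [pickDensity, if_pos h]
  · by_cases hn : ∃ k : ℕ, t = -(k : ℝ)
    · rw [pickDensity, if_neg (not_le.2 h), if_pos hn]
      exact le_top
    · have hn' : ∀ n : ℕ, (n : ℝ) ≠ -t := fun n hn' => hn ⟨n, by linarith⟩
      have := pickDensity_neg (t := -t) (by linarith) hn'
      rw [neg_neg] at this
      rw [this]
      exact_mod_cast density_nonneg (by linarith) hn'

/-! ### Monotone convergence of the approximating densities -/

/-- On `(0, N)` the numerators decrease with `N`: with `x = N + 1 - t`, the difference is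
`log (1 + t / x) + t log (1 - 1 / x)`, and `log (1 + y) ≤ y` applies to both terms. -/
lemma approxNumer_succ_le {N : ℕ} {t : ℝ} (ht : 0 < t) (htN : t < N) :
    approxNumer (N + 1) t ≤ approxNumer N t := by
  have hx : 0 < (N : ℝ) - t := by linarith
  have hx1 : 0 < (N : ℝ) + 1 - t := by linarith
  have hN : (0 : ℝ) < (N : ℝ) + 1 := by positivity
  have l1 : Real.log (N - t) - Real.log (N + 1 - t) ≤ -(1 / (N + 1 - t)) := by
    rw [← Real.log_div hx.ne' hx1.ne']
    refine (Real.log_le_sub_one_of_pos (div_pos hx hx1)).trans (le_of_eq ?_)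
    field_simp
    ring
  have l2 : Real.log (N + 1) - Real.log (N + 1 - t) ≤ t / (N + 1 - t) := by
    rw [← Real.log_div hN.ne' hx1.ne']
    refine (Real.log_le_sub_one_of_pos (div_pos hN hx1)).trans (le_of_eq ?_)
    field_simp
    ring
  have l3 := mul_le_mul_of_nonneg_left l1 ht.le
  have l4 : t * -(1 / ((N : ℝ) + 1 - t)) = -(t / (N + 1 - t)) := by ring
  rw [approxNumer, approxNumer, Finset.sum_range_succ, logKernel, logKernel, logKernel]
  push_cast
  rw [if_neg (by linarith), if_neg (by linarith), abs_of_pos hx, abs_of_pos hx1]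
  linarith

lemma approxNumer_antitone {N N' : ℕ} (h : N ≤ N') {t : ℝ} (ht : 0 < t) (htN : t < N) :
    approxNumer N' t ≤ approxNumer N t := by
  induction N', h using Nat.le_induction with
  | base => exact le_rfl
  | succ k hk ih =>
    refine (approxNumer_succ_le ht (htN.trans_le ?_)).trans ih
    exact_mod_cast hk

lemma tendsto_log_natCast_add_sub (c : ℝ) :
    Tendsto (fun N : ℕ => Real.log (N + c) - Real.log N) atTop (𝓝 0) :=
  (Real.tendsto_log_comp_add_sub_log c).comp tendsto_natCast_atTop_atTop

lemma sum_ite_lt_eq_floor_mul {t : ℝ} (ht : 0 < t) (hn : ∀ n : ℕ, (n : ℝ) ≠ t) {N : ℕ} (hN : t < N) :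
    ∑ n ∈ Finset.range N, (if (n : ℝ) + 1 < t then Real.log t else 0) = ⌊t⌋₊ * Real.log t := by
  rw [← Finset.sum_filter, Finset.sum_const, nsmul_eq_mul]
  congr 2
  have : (Finset.range N).filter (fun n : ℕ => (n : ℝ) + 1 < t) = Finset.range ⌊t⌋₊ := by
    ext n
    rw [Finset.mem_filter, Finset.mem_range, Finset.mem_range]
    constructor
    · rintro ⟨-, h⟩
      have : n + 1 ≤ ⌊t⌋₊ := Nat.le_floor (by push_cast; exact h.le)
      omega
    · intro h
      have h1 : ((n + 1 : ℕ) : ℝ) ≤ ⌊t⌋₊ := by exact_mod_cast h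
      have h2 := floor_lt_of_forall_ne ht hn
      push_cast at h1
      refine ⟨?_, by linarith⟩
      have : (n : ℝ) < N := by linarith
      exact_mod_cast this
  rw [this, Finset.card_range]

/-- The limit of the numerators is given by Euler's limit formula for `Γ (1 - t)`. -/
lemma tendsto_approxNumer {t : ℝ} (ht : 0 < t) (hn : ∀ n : ℕ, (n : ℝ) ≠ t) :
    Tendsto (fun N => approxNumer N t) atTop (𝓝 (densityNumer t)) := by
  have hΓ : Real.Gamma (1 - t) ≠ 0 := by
    refine Real.Gamma_ne_zero fun k hk => ?_
    exact hn (k + 1) (by push_cast; linarith)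
  have h1 := ((Real.GammaSeq_tendsto_Gamma (1 - t)).abs).log (abs_ne_zero.2 hΓ)
  have h2 := tendsto_log_natCast_add_sub (-t)
  have h3 := tendsto_log_natCast_add_sub (1 - t)
  have h4 := ((h1.sub (h2.const_mul t)).add h3).add_const (⌊t⌋₊ * Real.log t)
  rw [mul_zero, sub_zero, add_zero] at h4
  refine h4.congr' ?_
  filter_upwards [tendsto_natCast_atTop_atTop.eventually (eventually_gt_atTop t),
    eventually_gt_atTop 0] with N hN hN0
  have hN0' : (0 : ℝ) < N := by exact_mod_cast hN0
  have hfac : ∀ j : ℕ, |1 - t + j| ≠ 0 := by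
    intro j
    refine abs_ne_zero.2 fun h => hn (j + 1) ?_
    push_cast
    linarith
  have hlogseq : Real.log |Real.GammaSeq (1 - t) N| = (1 - t) * Real.log N +
      ∑ n ∈ Finset.range N, Real.log (n + 1) -
      (∑ n ∈ Finset.range N, Real.log |(n : ℝ) + 1 - t| + Real.log (N + (1 - t))) := by
    have hf : Real.log (N.factorial : ℝ) = ∑ n ∈ Finset.range N, Real.log (n + 1) := by
      rw [← Finset.prod_range_add_one_eq_factorial]
      push_cast
      rw [Real.log_prod fun n _ => by positivity]
    rw [Real.GammaSeq, abs_div, abs_mul, Finset.abs_prod, Real.log_div, Real.log_mul,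
      Real.log_prod fun j _ => hfac j, abs_of_pos (Real.rpow_pos_of_pos hN0' _),
      Real.log_rpow hN0', Nat.abs_cast, hf, Finset.sum_range_succ]
    · congr 2
      · refine Finset.sum_congr rfl fun n _ => ?_
        congr 2
        ring
      · rw [abs_of_pos (by linarith)]
        congr 1
        ring
    · exact abs_ne_zero.2 (Real.rpow_pos_of_pos hN0' _).ne'
    · exact abs_ne_zero.2 (by positivity)
    · exact mul_ne_zero (abs_ne_zero.2 (Real.rpow_pos_of_pos hN0' _).ne')
        (abs_ne_zero.2 (by positivity))
    · exact Finset.prod_ne_zero_iff.2 fun j _ => hfac j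
  rw [hlogseq, approxNumer]
  simp only [logKernel]
  rw [Finset.sum_add_distrib, Finset.sum_sub_distrib, sum_ite_lt_eq_floor_mul ht hn hN,
    if_neg (by linarith), abs_of_pos (by linarith), ← sub_eq_add_neg]
  ring

lemma densityNumer_le_approxNumer {N : ℕ} {t : ℝ} (ht : 0 < t) (hn : ∀ n : ℕ, (n : ℝ) ≠ t)
    (htN : t < N) : densityNumer t ≤ approxNumer N t := by
  refine le_of_tendsto (tendsto_approxNumer ht hn) ?_
  filter_upwards [eventually_ge_atTop N] with N' h using approxNumer_antitone h ht htN

/-- For `t > N` all terms are non-negative; for `t < N` the value exceeds its limit in `N`. -/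
lemma approxNumer_nonneg (N : ℕ) {t : ℝ} (ht : 0 < t) (hn : ∀ n : ℕ, (n : ℝ) ≠ t) :
    0 ≤ approxNumer N t := by
  rcases lt_or_gt_of_ne (hn N) with h | h
  · have hk : ∀ a : ℝ, 0 ≤ a → a < t → 0 ≤ logKernel a t := by
      intro a ha hat
      rw [logKernel, if_pos hat, abs_sub_comm, abs_of_pos (by linarith)]
      exact sub_nonneg.2 (Real.log_le_log (by linarith) (by linarith))
    refine add_nonneg (mul_nonneg ht.le (hk N (by positivity) h)) (Finset.sum_nonneg fun n hnN => ?_)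
    have h1 : ((n + 1 : ℕ) : ℝ) ≤ N := by exact_mod_cast Finset.mem_range.1 hnN
    push_cast at h1
    refine add_nonneg (hk _ (by positivity) (by linarith)) (Real.log_nonneg ?_)
    have : (0 : ℝ) ≤ n := by positivity
    linarith
  · exact (densityNumer_nonneg ht hn).trans (densityNumer_le_approxNumer ht hn h)

lemma approxDensity_nonneg (N : ℕ) {t : ℝ} (ht : 0 < t) (hn : ∀ n : ℕ, (n : ℝ) ≠ t) :
    0 ≤ approxDensity N t :=
  div_nonneg (approxNumer_nonneg N ht hn) (mul_nonneg ht.le (log_sq_add_pi_sq_pos t).le)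

lemma density_le_approxDensity {N : ℕ} {t : ℝ} (ht : 0 < t) (hn : ∀ n : ℕ, (n : ℝ) ≠ t)
    (htN : t < N) : density t ≤ approxDensity N t :=
  div_le_div_of_nonneg_right (densityNumer_le_approxNumer ht hn htN)
    (mul_nonneg ht.le (log_sq_add_pi_sq_pos t).le)

lemma approxDensity_antitone {N N' : ℕ} (h : N ≤ N') {t : ℝ} (ht : 0 < t) (htN : t < N) :
    approxDensity N' t ≤ approxDensity N t :=
  div_le_div_of_nonneg_right (approxNumer_antitone h ht htN)
    (mul_nonneg ht.le (log_sq_add_pi_sq_pos t).le)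

lemma tendsto_approxDensity {t : ℝ} (ht : 0 < t) (hn : ∀ n : ℕ, (n : ℝ) ≠ t) :
    Tendsto (fun N => approxDensity N t) atTop (𝓝 (density t)) :=
  (tendsto_approxNumer ht hn).div_const _

lemma measurable_logKernel (a : ℝ) : Measurable (logKernel a) := by
  unfold logKernel
  refine Measurable.sub (Measurable.ite measurableSet_Ioi Real.measurable_log measurable_const) ?_
  exact Real.measurable_log.comp (by fun_prop)

lemma measurable_approxDensity (N : ℕ) : Measurable (approxDensity N) := by
  have h : Measurable (approxNumer N) :=
    (measurable_id.mul (measurable_logKernel N)).add (Finset.measurable_fun_sum _ fun n _ =>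
      (measurable_logKernel (n + 1)).add_const _)
  exact h.div (measurable_id.mul ((Real.measurable_log.pow_const 2).add_const _))

lemma aestronglyMeasurable_density : AEStronglyMeasurable density (volume.restrict (Ioi 0)) := by
  refine aestronglyMeasurable_of_tendsto_ae atTop
    (fun N => (measurable_approxDensity N).aestronglyMeasurable)
    ((ae_restrict_iff' measurableSet_Ioi).2 ?_)
  filter_upwards [ae_forall_natCast_ne] with t hn ht using tendsto_approxDensity ht hn

lemma intervalIntegrable_logKernel {a : ℝ} (x y : ℝ) :
    IntervalIntegrable (logKernel a) volume x y := by
  refine IntervalIntegrable.sub ?_ ?_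
  · have h : IntervalIntegrable Real.log volume x y := intervalIntegral.intervalIntegrable_log'
    rw [intervalIntegrable_iff] at h ⊢
    refine Integrable.mono h (Measurable.ite measurableSet_Ioi Real.measurable_log
      measurable_const).aestronglyMeasurable (Eventually.of_forall fun t => ?_)
    split_ifs
    · exact le_rfl
    · simp
  · exact MeromorphicOn.intervalIntegrable_log_norm (f := fun t : ℝ => a - t)
      fun u _ => by fun_prop

end Density

/-! ### Convergence of the approximants to `log Γ` -/

section LogGamma

open Complex Filter Topology

lemma log_one_add_div_ofReal {a : ℝ} (ha : 0 < a) {s : ℂ} (h : (a : ℂ) + s ≠ 0) :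
    Complex.log (1 + s / a) = Complex.log (a + s) - Real.log a := by
  have ha' : (a : ℂ) ≠ 0 := by exact_mod_cast ha.ne'
  have h1 : (a : ℂ) + s = (a : ℝ) * (1 + s / a) := by field_simp
  have h2 : 1 + s / a ≠ 0 := by
    intro h0
    rw [h0, mul_zero] at h1
    exact h h1
  rw [h1, Complex.log_ofReal_mul ha h2]
  ring

lemma tendsto_log_natCast_add_sub_log (c : ℂ) :
    Tendsto (fun N : ℕ => Complex.log ((N : ℝ) + c) - Real.log N) atTop (𝓝 0) := by
  have h0 : Tendsto (fun N : ℕ => 1 + c / ((N : ℝ) : ℂ)) atTop (𝓝 1) := by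
    have : Tendsto (fun N : ℕ => c / (N : ℂ)) atTop (𝓝 0) :=
      tendsto_const_div_atTop_nhds_zero_nat c
    simpa using this.const_add 1
  have h1 := h0.clog (by simp)
  rw [Complex.log_one] at h1
  refine h1.congr' ?_
  filter_upwards [tendsto_natCast_atTop_atTop.eventually (eventually_gt_atTop ‖c‖)] with N hN
  refine log_one_add_div_ofReal ((norm_nonneg c).trans_lt hN) fun h => ?_
  have h2 : ‖((N : ℝ) : ℂ)‖ = ‖c‖ := by rw [eq_neg_of_add_eq_zero_left h, norm_neg]
  rw [norm_real, Real.norm_of_nonneg (by positivity)] at h2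
  exact hN.ne' h2

lemma summable_log_one_add_sub (s : ℂ) :
    Summable fun n : ℕ => Complex.log (1 + s / ((n : ℂ) + 1)) - s / ((n : ℂ) + 1) := by
  have hs : Summable fun n : ℕ => ‖s‖ ^ 2 * (1 / ((n : ℝ) + 1) ^ 2) := by
    refine Summable.mul_left _ ?_
    have := (summable_nat_add_iff 1).2 (Real.summable_one_div_nat_pow.2 one_lt_two)
    exact_mod_cast this
  refine Summable.of_norm_bounded_eventually_nat hs ?_
  filter_upwards [tendsto_natCast_atTop_atTop.eventually (eventually_ge_atTop (2 * ‖s‖))] with n hn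
  have hn1 : ‖(n : ℂ) + 1‖ = (n : ℝ) + 1 := by
    rw [show (n : ℂ) + 1 = ((n + 1 : ℝ) : ℂ) by push_cast; rfl, norm_real,
      Real.norm_of_nonneg (by positivity)]
  have hx : ‖s / ((n : ℂ) + 1)‖ ≤ 1 / 2 := by
    rw [norm_div, hn1, div_le_iff₀ (by positivity)]
    linarith
  refine (Complex.norm_log_one_add_sub_self_le (hx.trans_lt (by norm_num))).trans ?_
  have h2 : (1 - ‖s / ((n : ℂ) + 1)‖)⁻¹ ≤ 2 := by
    rw [inv_le_comm₀ (by linarith) two_pos]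
    linarith
  calc ‖s / ((n : ℂ) + 1)‖ ^ 2 * (1 - ‖s / ((n : ℂ) + 1)‖)⁻¹ / 2
      ≤ ‖s / ((n : ℂ) + 1)‖ ^ 2 * 2 / 2 := by gcongr
    _ = ‖s‖ ^ 2 * (1 / ((n : ℝ) + 1) ^ 2) := by
        rw [norm_div, hn1, div_pow]
        ring

lemma add_one_mem_slitPlane {z : ℂ} (hz : z ∈ slitPlane) : z + 1 ∈ slitPlane := by
  have := ofReal_add_mem_slitPlane (a := 1) zero_le_one hz
  rwa [ofReal_one, add_comm] at this

lemma tendsto_approxLogGamma {z : ℂ} (hz : z ∈ slitPlane) :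
    Tendsto (fun N => approxLogGamma N z) atTop (𝓝 (complexLogGamma (z + 1))) := by
  set s := z + 1 with hs
  have hs' : s ∈ slitPlane := add_one_mem_slitPlane hz
  have hpart := (summable_log_one_add_sub s).hasSum.tendsto_sum_nat
  have hharm : Tendsto (fun N : ℕ => (((harmonic N : ℝ) - Real.log N : ℝ) : ℂ)) atTop
      (𝓝 (Real.eulerMascheroniConstant : ℂ)) :=
    (continuous_ofReal.tendsto _).comp Real.tendsto_harmonic_sub_log
  have hlim := (((hpart.const_sub
    (-(Real.eulerMascheroniConstant : ℂ) * s - Complex.log s)).sub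
      ((hharm.sub_const (Real.eulerMascheroniConstant : ℂ)).const_mul s)).add
      ((tendsto_log_natCast_add_sub_log z).const_mul z)).add (tendsto_log_natCast_add_sub_log s)
  rw [sub_self, mul_zero, mul_zero, sub_zero, add_zero, add_zero] at hlim
  rw [complexLogGamma]
  refine hlim.congr fun N => ?_
  have hterm : ∀ n : ℕ, Complex.log (1 + s / ((n : ℂ) + 1)) - s / ((n : ℂ) + 1) =
      Complex.log ((n + 1 : ℝ) + s) - Real.log (n + 1) - s * ((n : ℂ) + 1)⁻¹ := by
    intro n
    have := log_one_add_div_ofReal (a := n + 1) (s := s) (by positivity)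
      (slitPlane_ne_zero (ofReal_add_mem_slitPlane (by positivity) hs'))
    push_cast at this ⊢
    rw [this]
    ring
  have hH : ((harmonic N : ℝ) : ℂ) = ∑ n ∈ Finset.range N, ((n : ℂ) + 1)⁻¹ := by
    rw [harmonic]
    push_cast
    rfl
  have hshift : Complex.log s + ∑ n ∈ Finset.range N, Complex.log ((n + 1 : ℝ) + s) =
      (∑ n ∈ Finset.range N, Complex.log ((n + 1 : ℝ) + z)) + Complex.log ((N : ℝ) + s) := by
    have h1 := Finset.sum_range_succ (fun n : ℕ => Complex.log ((n : ℝ) + s)) N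
    rw [Finset.sum_range_succ'] at h1
    have h2 : ∀ n : ℕ, Complex.log ((n : ℝ) + s) = Complex.log ((n + 1 : ℝ) + z) := by
      intro n
      rw [hs]
      push_cast
      ring_nf
    rw [Finset.sum_congr rfl (fun n _ => h2 n)] at h1
    rw [← h1]
    push_cast
    rw [zero_add]
    ring
  simp only [hterm]
  rw [approxLogGamma, Finset.sum_sub_distrib, Finset.sum_sub_distrib, Finset.sum_sub_distrib,
    ← Finset.mul_sum, ofReal_sub, hH]
  push_cast at hshift ⊢
  linear_combination (-1 : ℂ) * hshift - Real.log N * hs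

lemma complexLogGamma_ofReal_add_one {x : ℝ} (hx : 0 < x) :
    complexLogGamma (x + 1) = Real.log (Real.Gamma (x + 1)) := by
  have h1 := tendsto_approxLogGamma (z := (x : ℂ)) (Or.inl (by simpa using hx))
  refine tendsto_nhds_unique h1 ?_
  have h2 := Real.BohrMollerup.tendsto_log_gamma (x := x + 1) (by linarith)
  have h3 := tendsto_log_natCast_add_sub x
  have h4 := tendsto_log_natCast_add_sub (x + 1)
  have h5 := (h2.add (h3.const_mul x)).add h4
  rw [mul_zero, add_zero, add_zero] at h5
  refine ((continuous_ofReal.tendsto _).comp h5).congr fun N => ?_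
  have hf : Real.log (N.factorial : ℝ) = ∑ n ∈ Finset.range N, Real.log (n + 1) := by
    rw [← Finset.prod_range_add_one_eq_factorial]
    push_cast
    rw [Real.log_prod fun n _ => by positivity]
  have hlog : ∀ a : ℝ, 0 ≤ a → Complex.log (a + x) = (Real.log (a + x) : ℝ) := by
    intro a ha
    rw [ofReal_log (by linarith)]
    push_cast
    rfl
  have happ : approxLogGamma N x = ((x * Real.log (N + x) -
      ∑ n ∈ Finset.range N, (Real.log (n + 1 + x) - Real.log (n + 1)) : ℝ) : ℂ) := by
    rw [approxLogGamma, hlog N (by positivity)]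
    have : ∀ n : ℕ, Complex.log ((n + 1 : ℝ) + x) = (Real.log (n + 1 + x) : ℝ) := fun n =>
      hlog (n + 1) (by positivity)
    simp only [this]
    push_cast
    rfl
  rw [happ, Function.comp_apply, Real.BohrMollerup.logGammaSeq, hf, Finset.sum_sub_distrib,
    Finset.sum_range_succ]
  congr 1
  have h6 : ∀ n : ℕ, Real.log (x + 1 + n) = Real.log (n + 1 + x) := fun n => by ring_nf
  simp only [h6]
  rw [show (N : ℝ) + (x + 1) = N + 1 + x by ring]
  ring

/-- Stirling's approximation at the integers, to leading order. -/
lemma tendsto_log_factorial_div :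
    Tendsto (fun n : ℕ => Real.log n.factorial / (n * Real.log n)) atTop (𝓝 1) := by
  have hlog : Tendsto (fun n : ℕ => Real.log n) atTop atTop :=
    Real.tendsto_log_atTop.comp tendsto_natCast_atTop_atTop
  have hlow : Tendsto (fun n : ℕ => 1 - (Real.log n)⁻¹) atTop (𝓝 1) := by
    simpa using (tendsto_inv_atTop_zero.comp hlog).const_sub 1
  refine tendsto_of_tendsto_of_tendsto_of_le_of_le' hlow tendsto_const_nhds ?_ ?_
  · filter_upwards [eventually_gt_atTop 1] with n hn
    have hn' : (1 : ℝ) < n := by exact_mod_cast hn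
    have hl := Real.log_pos hn'
    have hf : (0 : ℝ) < n.factorial := by exact_mod_cast n.factorial_pos
    have h1 := Real.pow_div_factorial_le_exp (x := n) (by positivity) n
    have h2 := Real.log_le_log (by positivity) h1
    rw [Real.log_exp, Real.log_div (by positivity) hf.ne', Real.log_pow] at h2
    rw [le_div_iff₀ (by positivity)]
    have h3 : (1 - (Real.log n)⁻¹) * (n * Real.log n) = n * Real.log n - n := by
      field_simp
    rw [h3]
    linarith
  · filter_upwards [eventually_gt_atTop 1] with n hn
    have hn' : (1 : ℝ) < n := by exact_mod_cast hn
    have hl := Real.log_pos hn'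
    have hf : (0 : ℝ) < n.factorial := by exact_mod_cast n.factorial_pos
    rw [div_le_one (by positivity), ← Real.log_pow]
    exact Real.log_le_log hf (by exact_mod_cast Nat.factorial_le_pow n)

end LogGamma

/-! ### Differentiating Stieltjes transforms -/

section StieltjesTransform

open Filter Topology

variable {𝕜 : Type*} [RCLike 𝕜]

/-- A uniform distance of `z` from `(-∞, 0)` gives linear growth of the denominators. -/
lemma exists_add_two_le_mul_norm {z : 𝕜} {c : ℝ} (hc : 0 < c)
    (h : ∀ t : ℝ, 0 < t → c ≤ ‖(t : 𝕜) + z‖) :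
    ∃ C : ℝ, 0 < C ∧ ∀ t : ℝ, 0 < t → t + 2 ≤ C * ‖(t : 𝕜) + z‖ := by
  refine ⟨1 + (2 + ‖z‖) / c, by positivity, fun t ht => ?_⟩
  have h1 : t - ‖z‖ ≤ ‖(t : 𝕜) + z‖ := by
    have := norm_sub_norm_le (t : 𝕜) (-z)
    rwa [norm_neg, RCLike.norm_of_nonneg ht.le, sub_neg_eq_add] at this
  have h2 : 2 + ‖z‖ ≤ (2 + ‖z‖) / c * ‖(t : 𝕜) + z‖ := by
    rw [div_mul_eq_mul_div, le_div_iff₀ hc]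
    exact mul_le_mul_of_nonneg_left (h t ht) (by positivity)
  linarith

lemma norm_stieltjes_le {m t c C : ℝ} (hc : 0 < c) (ht : 0 < t) {x : 𝕜} (h1 : c ≤ ‖x‖)
    (h2 : t + 2 ≤ C * ‖x‖) (n : ℕ) : ‖(m : 𝕜) / x ^ (n + 1)‖ ≤ C / c ^ n * ‖m / (t + 2)‖ := by
  have hx : 0 < ‖x‖ := hc.trans_le h1
  rw [norm_div, norm_div, norm_pow, RCLike.norm_ofReal, Real.norm_eq_abs,
    Real.norm_of_nonneg (by linarith : 0 ≤ t + 2), div_mul_div_comm,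
    div_le_div_iff₀ (by positivity) (by positivity)]
  have hp : c ^ n ≤ ‖x‖ ^ n := by gcongr
  calc |m| * (c ^ n * (t + 2)) ≤ |m| * (‖x‖ ^ n * (C * ‖x‖)) := by gcongr
    _ = C * |m| * ‖x‖ ^ (n + 1) := by ring

lemma aestronglyMeasurable_of_integrableOn_div {m : ℝ → ℝ}
    (hm : IntegrableOn (fun t => m t / (t + 2)) (Ioi 0)) :
    AEStronglyMeasurable m (volume.restrict (Ioi 0)) := by
  have h : AEStronglyMeasurable (fun t : ℝ => m t / (t + 2) * (t + 2)) (volume.restrict (Ioi 0)) :=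
    hm.aestronglyMeasurable.mul (by fun_prop)
  refine h.congr ((ae_restrict_iff' measurableSet_Ioi).2 (ae_of_all _ fun t ht => ?_))
  have : t + 2 ≠ 0 := by
    have := mem_Ioi.1 ht
    linarith
  exact div_mul_cancel₀ _ this

lemma aestronglyMeasurable_stieltjes {m : ℝ → ℝ}
    (hm : IntegrableOn (fun t => m t / (t + 2)) (Ioi 0)) (z : 𝕜) (n : ℕ) :
    AEStronglyMeasurable (fun t : ℝ => (m t : 𝕜) / ((t : 𝕜) + z) ^ n)
      (volume.restrict (Ioi 0)) := by
  have h1 : AEStronglyMeasurable (fun t : ℝ => (m t : 𝕜)) (volume.restrict (Ioi 0)) :=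
    RCLike.continuous_ofReal.comp_aestronglyMeasurable (aestronglyMeasurable_of_integrableOn_div hm)
  have h2 : Measurable (fun t : ℝ => (((t : 𝕜) + z) ^ n)⁻¹) := by
    have : Measurable (fun t : ℝ => ((t : 𝕜) + z) ^ n) :=
      (Continuous.pow (RCLike.continuous_ofReal.add continuous_const) n).measurable
    exact this.inv
  simp only [div_eq_mul_inv]
  exact h1.mul h2.aestronglyMeasurable

lemma integrableOn_stieltjes {m : ℝ → ℝ} (hm : IntegrableOn (fun t => m t / (t + 2)) (Ioi 0))
    {z : 𝕜} {c : ℝ} (hc : 0 < c) (h : ∀ t : ℝ, 0 < t → c ≤ ‖(t : 𝕜) + z‖) (n : ℕ) :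
    IntegrableOn (fun t : ℝ => (m t : 𝕜) / ((t : 𝕜) + z) ^ (n + 1)) (Ioi 0) := by
  obtain ⟨C, hC, hC'⟩ := exists_add_two_le_mul_norm hc h
  refine Integrable.mono' (hm.norm.const_mul (C / c ^ n))
    (aestronglyMeasurable_stieltjes hm z _)
    ((ae_restrict_iff' measurableSet_Ioi).2 (ae_of_all _ fun t ht => ?_))
  exact norm_stieltjes_le hc ht (h t ht) (hC' t ht) n

/-- Differentiation of the (iterated) Stieltjes transform under the integral sign. -/
lemma hasDerivAt_stieltjes {m : ℝ → ℝ} (hm : IntegrableOn (fun t => m t / (t + 2)) (Ioi 0))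
    {z : 𝕜} {c : ℝ} (hc : 0 < c) (h : ∀ t : ℝ, 0 < t → c ≤ ‖(t : 𝕜) + z‖) (n : ℕ) :
    HasDerivAt (fun x : 𝕜 => ∫ t in Ioi (0 : ℝ), (m t : 𝕜) / ((t : 𝕜) + x) ^ (n + 1))
      (-(n + 1) * ∫ t in Ioi (0 : ℝ), (m t : 𝕜) / ((t : 𝕜) + z) ^ (n + 2)) z := by
  obtain ⟨C, hC, hC'⟩ := exists_add_two_le_mul_norm hc h
  have hnear : ∀ t : ℝ, 0 < t → ∀ x ∈ Metric.ball z (c / 2),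
      ‖(t : 𝕜) + z‖ ≤ 2 * ‖(t : 𝕜) + x‖ := by
    intro t ht x hx
    rw [mem_ball_iff_norm'] at hx
    have h1 : ‖(t : 𝕜) + z‖ ≤ ‖(t : 𝕜) + x‖ + ‖z - x‖ := by
      have := norm_add_le ((t : 𝕜) + x) (z - x)
      rwa [show (t : 𝕜) + x + (z - x) = t + z by ring] at this
    linarith [h t ht]
  have key := hasDerivAt_integral_of_dominated_loc_of_deriv_le (μ := volume.restrict (Ioi (0 : ℝ)))
    (F := fun (x : 𝕜) (t : ℝ) => (m t : 𝕜) / ((t : 𝕜) + x) ^ (n + 1))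
    (F' := fun (x : 𝕜) (t : ℝ) => -(n + 1) * ((m t : 𝕜) / ((t : 𝕜) + x) ^ (n + 2)))
    (bound := fun t => (n + 1) * ((2 * C) / (c / 2) ^ (n + 1) * ‖m t / (t + 2)‖))
    (Metric.ball_mem_nhds z (half_pos hc))
    (Eventually.of_forall fun x => aestronglyMeasurable_stieltjes hm x _)
    (integrableOn_stieltjes hm hc h n)
    ((aestronglyMeasurable_stieltjes hm z _).const_mul _)
    ((ae_restrict_iff' measurableSet_Ioi).2 (ae_of_all _ fun t ht x hx => ?_))
    ((hm.norm.const_mul _).const_mul _)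
    ((ae_restrict_iff' measurableSet_Ioi).2 (ae_of_all _ fun t ht x hx => ?_))
  · rw [← integral_const_mul]
    exact key.2
  · have h1 := hnear t ht x hx
    have h2 := h t ht
    rw [norm_mul, norm_neg]
    have hn : ‖((n : 𝕜) + 1)‖ = (n : ℝ) + 1 := by
      have := RCLike.norm_natCast (K := 𝕜) (n + 1)
      push_cast at this
      exact this
    rw [hn]
    gcongr
    refine norm_stieltjes_le (half_pos hc) ht (by linarith) ?_ (n + 1)
    have := hC' t ht
    have h3 := mul_le_mul_of_nonneg_left h1 hC.le
    linarith
  · have hx0 : (t : 𝕜) + x ≠ 0 := by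
      intro h0
      have h1 := hnear t ht x hx
      rw [h0, norm_zero] at h1
      linarith [h t ht]
    have hd : HasDerivAt (fun x : 𝕜 => ((t : 𝕜) + x) ^ (n + 1))
        (((n + 1 : ℕ) : 𝕜) * ((t : 𝕜) + x) ^ n * 1) x :=
      ((hasDerivAt_id x).const_add (t : 𝕜)).pow (n + 1)
    have := (hasDerivAt_const x (m t : 𝕜)).div hd (pow_ne_zero _ hx0)
    refine this.congr_deriv ?_
    push_cast
    field_simp
    ring

/-- The derivatives of a Stieltjes transform on the positive half-line. -/
lemma iteratedDeriv_stieltjes {m : ℝ → ℝ} (hm : IntegrableOn (fun t => m t / (t + 2)) (Ioi 0))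
    (n : ℕ) {x : ℝ} (hx : 0 < x) :
    iteratedDeriv n (fun y : ℝ => ∫ t in Ioi (0 : ℝ), m t / (t + y)) x =
      (-1) ^ n * n.factorial * ∫ t in Ioi (0 : ℝ), m t / (t + x) ^ (n + 1) := by
  induction n generalizing x with
  | zero => simp
  | succ n ih =>
    rw [iteratedDeriv_succ]
    have hev : iteratedDeriv n (fun y : ℝ => ∫ t in Ioi (0 : ℝ), m t / (t + y)) =ᶠ[𝓝 x]
        fun y => (-1) ^ n * n.factorial * ∫ t in Ioi (0 : ℝ), m t / (t + y) ^ (n + 1) := by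
      filter_upwards [lt_mem_nhds hx] with y hy using ih hy
    rw [hev.deriv_eq]
    have h := hasDerivAt_stieltjes (𝕜 := ℝ) hm hx (z := x) (fun t ht => by
      rw [RCLike.ofReal_real_eq_id, id, Real.norm_of_nonneg (by linarith)]
      linarith) n
    simp only [RCLike.ofReal_real_eq_id, id] at h
    rw [(h.const_mul ((-1) ^ n * (n.factorial : ℝ))).deriv, Nat.factorial_succ]
    push_cast
    ring

end StieltjesTransform

/-! ### The limit of the approximating representations -/

section Representation

open Filter Topology

lemma exists_pos_le_norm_add {z : ℂ} (hz : z ∈ Complex.slitPlane) :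
    ∃ c : ℝ, 0 < c ∧ ∀ t : ℝ, 0 < t → c ≤ ‖(t : ℂ) + z‖ := by
  rcases Complex.mem_slitPlane_iff.1 hz with h | h
  · refine ⟨z.re, h, fun t ht => ?_⟩
    have := Complex.re_le_norm ((t : ℂ) + z)
    rw [Complex.add_re, Complex.ofReal_re] at this
    linarith
  · refine ⟨|z.im|, abs_pos.2 h, fun t ht => ?_⟩
    have := Complex.abs_im_le_norm ((t : ℂ) + z)
    rwa [Complex.add_im, Complex.ofReal_im, zero_add] at this

lemma integrableOn_stieltjes_slitPlane {m : ℝ → ℝ}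
    (hm : IntegrableOn (fun t => m t / (t + 2)) (Ioi 0)) {z : ℂ} (hz : z ∈ Complex.slitPlane) :
    IntegrableOn (fun t : ℝ => (m t : ℂ) / ((t : ℂ) + z)) (Ioi 0) := by
  obtain ⟨c, hc, h⟩ := exists_pos_le_norm_add hz
  simpa using integrableOn_stieltjes (𝕜 := ℂ) hm hc h 0

lemma two_mem_slitPlane : (2 : ℂ) ∈ Complex.slitPlane := Or.inl (by norm_num)

lemma ofReal_integral_div_add (m : ℝ → ℝ) (s : Set ℝ) (x : ℝ) :
    ∫ t in s, (m t : ℂ) / ((t : ℂ) + x) = ((∫ t in s, m t / (t + x) : ℝ) : ℂ) := by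
  rw [← integral_complex_ofReal]
  push_cast
  rfl

/-! ### The approximating representation -/

lemma aecover_Ioc_exp : AECover (volume.restrict (Ioi (0 : ℝ))) atTop
    fun R : ℝ => Ioc (Real.exp (-R)) (Real.exp R) where
  ae_eventually_mem := by
    refine (ae_restrict_iff' measurableSet_Ioi).2 (ae_of_all _ fun t ht => ?_)
    have h1 := Real.tendsto_exp_neg_atTop_nhds_zero.eventually (gt_mem_nhds (mem_Ioi.1 ht))
    filter_upwards [h1, Real.tendsto_exp_atTop.eventually (eventually_ge_atTop t)] with R a b
    exact ⟨a, b⟩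
  measurableSet _ := measurableSet_Ioc

lemma restrict_restrict_Ioc_exp (R : ℝ) :
    (volume.restrict (Ioi (0 : ℝ))).restrict (Ioc (Real.exp (-R)) (Real.exp R)) =
      volume.restrict (Ioc (Real.exp (-R)) (Real.exp R)) :=
  Measure.restrict_restrict_of_subset fun _ ht => (Real.exp_pos _).trans ht.1

lemma integrableOn_approxDensity_Ioc (N : ℕ) (R : ℝ) :
    IntegrableOn (fun t => approxDensity N t / (t + 2))
      (Ioc (Real.exp (-R)) (Real.exp R)) := by
  have hnum : IntervalIntegrable (approxNumer N) volume (Real.exp (-R)) (Real.exp R) := by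
    refine ((intervalIntegrable_logKernel _ _).continuousOn_mul continuousOn_id).add ?_
    have := IntervalIntegrable.sum (Finset.range N) (μ := volume)
      (f := fun (n : ℕ) t => logKernel (n + 1) t + Real.log (n + 1)) fun n _ =>
        (intervalIntegrable_logKernel (a := n + 1) (Real.exp (-R)) (Real.exp R)).add
          intervalIntegrable_const
    refine this.congr fun u _ => ?_
    simp
  rcases le_or_gt (Real.exp R) (Real.exp (-R)) with hR | hR
  · rw [Ioc_eq_empty (not_lt.2 hR)]
    exact integrableOn_empty
  have hcont : ContinuousOn (fun t : ℝ => (t * (Real.log t ^ 2 + Real.pi ^ 2) * (t + 2))⁻¹)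
      (uIcc (Real.exp (-R)) (Real.exp R)) := by
    have hpos : ∀ t ∈ uIcc (Real.exp (-R)) (Real.exp R), 0 < t := by
      intro t ht
      rw [uIcc_of_le hR.le] at ht
      exact (Real.exp_pos _).trans_le ht.1
    have hlog : ContinuousOn Real.log (uIcc (Real.exp (-R)) (Real.exp R)) :=
      ContinuousOn.log continuousOn_id fun t ht => (hpos t ht).ne'
    refine ContinuousOn.inv₀ ((continuousOn_id.mul ((hlog.pow 2).add continuousOn_const)).mul
      (continuousOn_id.add continuousOn_const)) fun t ht => ?_
    have h1 := hpos t ht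
    have h2 := log_sq_add_pi_sq_pos t
    have h3 : 0 < t + 2 := by linarith
    exact (mul_pos (mul_pos h1 h2) h3).ne'
  have h := hnum.mul_continuousOn hcont
  rw [intervalIntegrable_iff_integrableOn_Ioc_of_le hR.le] at h
  refine h.congr_fun (fun t _ => ?_) measurableSet_Ioc
  simp only [approxDensity]
  rw [div_div, div_eq_mul_inv]

lemma ae_restrict_Ioi_of_forall_natCast_ne {p : ℝ → Prop}
    (h : ∀ t : ℝ, 0 < t → (∀ n : ℕ, (n : ℝ) ≠ t) → p t) : ∀ᵐ t ∂volume.restrict (Ioi (0 : ℝ)), p t :=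
  (ae_restrict_iff' measurableSet_Ioi).2 (ae_forall_natCast_ne.mono fun t hn ht => h t ht hn)

/-- Since the density is non-negative, convergence of the truncated integrals at `z = 2` already
gives integrability. -/
lemma integrableOn_approxDensity {N : ℕ} (hN : 0 < N) :
    IntegrableOn (fun t => approxDensity N t / (t + 2)) (Ioi 0) := by
  have h := tendsto_integral_approxDensity hN two_mem_slitPlane (by norm_num)
  have h' := (Complex.continuous_re.tendsto _).comp h
  refine aecover_Ioc_exp.integrable_of_integral_tendsto_of_nonneg_ae _ (fun R => ?_) ?_
    (h'.congr fun R => ?_)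
  · rw [IntegrableOn, restrict_restrict_Ioc_exp]
    exact integrableOn_approxDensity_Ioc N R
  · exact ae_restrict_Ioi_of_forall_natCast_ne fun t ht hn => div_nonneg (approxDensity_nonneg N ht hn) (by linarith)
  · rw [restrict_restrict_Ioc_exp, Function.comp_apply]
    have := ofReal_integral_div_add (approxDensity N) (Ioc (Real.exp (-R)) (Real.exp R)) 2
    rw [Complex.ofReal_ofNat] at this
    rw [this, Complex.ofReal_re]

lemma integral_approxDensity {N : ℕ} (hN : 0 < N) {z : ℂ} (hz : z ∈ Complex.slitPlane)
    (hz1 : z ≠ 1) : ∫ t in Ioi (0 : ℝ), (approxDensity N t : ℂ) / (t + z) =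
      1 - approxLogGamma N z / (z * Complex.log z) := by
  have h := aecover_Ioc_exp.integral_tendsto_of_countably_generated
    (integrableOn_stieltjes_slitPlane (integrableOn_approxDensity hN) hz)
  simp only [restrict_restrict_Ioc_exp] at h
  exact tendsto_nhds_unique h (tendsto_integral_approxDensity hN hz hz1)

lemma integral_approxDensity_ofReal {N : ℕ} (hN : 0 < N) {x : ℝ} (hx : 0 < x) (hx1 : x ≠ 1) :
    ∫ t in Ioi (0 : ℝ), approxDensity N t / (t + x) =
      ‖1 - approxLogGamma N x / (x * Complex.log x)‖ := by
  rw [← integral_approxDensity hN (Or.inl (by simpa using hx)) (by exact_mod_cast hx1),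
    ofReal_integral_div_add, Complex.norm_real, Real.norm_of_nonneg]
  exact setIntegral_nonneg_ae measurableSet_Ioi (ae_forall_natCast_ne.mono fun t hn ht =>
    div_nonneg (approxDensity_nonneg N ht hn) (by linarith [mem_Ioi.1 ht]))

/-! ### Passage to the limit -/

lemma tendsto_approxQuotient {z : ℂ} (hz : z ∈ Complex.slitPlane) :
    Tendsto (fun N => 1 - approxLogGamma N z / (z * Complex.log z)) atTop
      (𝓝 (1 - complexLogGamma (z + 1) / (z * Complex.log z))) :=
  ((tendsto_approxLogGamma hz).div_const _).const_sub 1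

lemma integrableOn_density_Ioc (M : ℕ) :
    IntegrableOn (fun t => density t / (t + 2)) (Ioc 0 M) := by
  refine Integrable.mono' ((integrableOn_approxDensity M.succ_pos).mono_set
    (fun t ht => ht.1 : Ioc (0 : ℝ) M ⊆ Ioi 0)) ?_ ?_
  · have h : AEStronglyMeasurable (fun t : ℝ => density t / (t + 2)) (volume.restrict (Ioi 0)) := by
      have h2 : Measurable (fun t : ℝ => (t + 2)⁻¹) := by fun_prop
      simp only [div_eq_mul_inv]
      exact aestronglyMeasurable_density.mul h2.aestronglyMeasurable
    exact h.mono_measure (Measure.restrict_mono (fun t ht => ht.1) le_rfl)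
  · refine (ae_restrict_iff' measurableSet_Ioc).2 (ae_forall_natCast_ne.mono fun t hn ht => ?_)
    have h2 : 0 ≤ t + 2 := by linarith [ht.1]
    rw [Real.norm_of_nonneg (div_nonneg (density_nonneg ht.1 hn) h2)]
    refine div_le_div_of_nonneg_right (density_le_approxDensity ht.1 hn ?_) h2
    push_cast
    linarith [ht.2]

/-- On `(0, M]` the density is at most its approximation with index `M + 1`, whose integral over
the whole half-line is bounded independently of `M`. -/
lemma integrableOn_density : IntegrableOn (fun t => density t / (t + 2)) (Ioi 0) := by
  have hlim := ((tendsto_approxQuotient two_mem_slitPlane).norm.comp (tendsto_add_atTop_nat 1))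
  obtain ⟨C, hC⟩ := hlim.isBoundedUnder_le
  refine integrableOn_Ioi_of_intervalIntegral_norm_bounded (l := atTop) (b := fun M : ℕ => (M : ℝ))
    C 0 (fun M => integrableOn_density_Ioc M) tendsto_natCast_atTop_atTop ?_
  filter_upwards [eventually_map.1 hC] with M hM
  refine le_trans ?_ hM
  have h2 := integral_approxDensity_ofReal M.succ_pos (x := 2) two_pos (by norm_num)
  rw [Complex.ofReal_ofNat] at h2
  rw [Function.comp_apply, ← Nat.succ_eq_add_one, ← h2,
    intervalIntegral.integral_of_le (by positivity)]
  have hint := integrableOn_approxDensity M.succ_pos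
  have hsub : Ioc (0 : ℝ) M ⊆ Ioi 0 := fun t ht => ht.1
  refine (setIntegral_mono_on_ae (integrableOn_density_Ioc M).norm (hint.mono_set hsub)
    measurableSet_Ioc (ae_forall_natCast_ne.mono fun t hn ht => ?_)).trans
    (setIntegral_mono_set hint ?_ hsub.eventuallyLE)
  · have h2 : 0 ≤ t + 2 := by linarith [ht.1]
    rw [Real.norm_of_nonneg (div_nonneg (density_nonneg ht.1 hn) h2)]
    refine div_le_div_of_nonneg_right (density_le_approxDensity ht.1 hn ?_) h2
    push_cast
    linarith [ht.2]
  · exact ae_restrict_Ioi_of_forall_natCast_ne fun t ht hn => div_nonneg (approxDensity_nonneg _ ht hn) (by linarith)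

/-- On a bounded interval the approximating densities are eventually dominated by one of them. -/
lemma tendsto_integral_Ioc_approxDensity {z : ℂ} (hz : z ∈ Complex.slitPlane) (M : ℕ) :
    Tendsto (fun N => ∫ t in Ioc (0 : ℝ) M, (approxDensity N t : ℂ) / (t + z)) atTop
      (𝓝 (∫ t in Ioc (0 : ℝ) M, (density t : ℂ) / (t + z))) := by
  have hint := integrableOn_stieltjes_slitPlane (integrableOn_approxDensity M.succ_pos) hz
  have hsub : Ioc (0 : ℝ) M ⊆ Ioi 0 := fun t ht => ht.1
  refine tendsto_integral_filter_of_dominated_convergence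
    (fun t : ℝ => ‖(approxDensity M.succ t : ℂ) / (t + z)‖) ?_ ?_ (hint.mono_set hsub).norm ?_
  · filter_upwards [eventually_gt_atTop 0] with N hN
    exact ((integrableOn_stieltjes_slitPlane (integrableOn_approxDensity hN) hz).mono_set
      hsub).aestronglyMeasurable
  · filter_upwards [eventually_ge_atTop M.succ] with N hN
    refine (ae_restrict_iff' measurableSet_Ioc).2 (ae_forall_natCast_ne.mono fun t hn ht => ?_)
    rw [norm_div, norm_div, Complex.norm_real, Complex.norm_real,
      Real.norm_of_nonneg (approxDensity_nonneg N ht.1 hn),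
      Real.norm_of_nonneg (approxDensity_nonneg M.succ ht.1 hn)]
    gcongr
    refine approxDensity_antitone hN ht.1 ?_
    push_cast
    linarith [ht.2]
  · refine (ae_restrict_iff' measurableSet_Ioc).2 (ae_forall_natCast_ne.mono fun t hn ht => ?_)
    exact ((Complex.continuous_ofReal.tendsto _).comp (tendsto_approxDensity ht.1 hn)).div_const _

/-- The tails of the approximating integrals at `z` are controlled, uniformly in `N`, by the
full integral at a large positive `x`, which is `1` minus the quotient at `x`. -/
lemma norm_integral_approxDensity_tail_le {N : ℕ} (hN : 0 < N) {z : ℂ}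
    (hz : z ∈ Complex.slitPlane) (hz1 : z ≠ 1) {x : ℝ} (hx : 1 < x) {M : ℕ}
    (hM : x + 2 * ‖z‖ ≤ M) :
    ‖1 - approxLogGamma N z / (z * Complex.log z) -
        ∫ t in Ioc (0 : ℝ) M, (approxDensity N t : ℂ) / (t + z)‖ ≤
      2 * ‖1 - approxLogGamma N x / (x * Complex.log x)‖ := by
  have hx0 : 0 < x := by linarith
  have hint := integrableOn_stieltjes_slitPlane (integrableOn_approxDensity hN) hz
  have hxs : (x : ℂ) ∈ Complex.slitPlane := Or.inl (by simpa using hx0)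
  have hintx : IntegrableOn (fun t => approxDensity N t / (t + x)) (Ioi 0) := by
    have := (integrableOn_stieltjes_slitPlane (integrableOn_approxDensity hN) hxs).re
    refine this.congr (ae_of_all _ fun t => ?_)
    have : ((approxDensity N t : ℂ) / (t + x)) = ((approxDensity N t / (t + x) : ℝ) : ℂ) := by
      push_cast
      rfl
    show ((approxDensity N t : ℂ) / (t + x)).re = _
    rw [this, Complex.ofReal_re]
  have hsub1 : Ioc (0 : ℝ) M ⊆ Ioi 0 := fun t ht => ht.1
  have hsub2 : Ioi (M : ℝ) ⊆ Ioi 0 := fun t ht => lt_of_le_of_lt (by positivity) (mem_Ioi.1 ht)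
  rw [← integral_approxDensity hN hz hz1, ← Ioc_union_Ioi_eq_Ioi (Nat.cast_nonneg M),
    setIntegral_union Ioc_disjoint_Ioi_same measurableSet_Ioi (hint.mono_set hsub1)
    (hint.mono_set hsub2), add_sub_cancel_left,
    ← integral_approxDensity_ofReal hN hx0 hx.ne', ← integral_const_mul]
  refine (norm_integral_le_integral_norm _).trans ?_
  refine (setIntegral_mono_on_ae (hint.mono_set hsub2).norm
    (IntegrableOn.mono_set (hintx.const_mul 2) hsub2)
    measurableSet_Ioi (ae_forall_natCast_ne.mono fun t hn ht => ?_)).trans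
    (setIntegral_mono_set (hintx.const_mul 2) ?_ hsub2.eventuallyLE)
  · have ht0 : 0 < t := hsub2 ht
    have htM : (M : ℝ) < t := ht
    rw [norm_div, Complex.norm_real, Real.norm_of_nonneg (approxDensity_nonneg N ht0 hn)]
    have h1 : t - ‖z‖ ≤ ‖(t : ℂ) + z‖ := by
      have := norm_sub_norm_le (t : ℂ) (-z)
      rwa [norm_neg, Complex.norm_real, Real.norm_of_nonneg ht0.le, sub_neg_eq_add] at this
    have h2 : (t + x) / 2 ≤ ‖(t : ℂ) + z‖ := by linarith
    calc approxDensity N t / ‖(t : ℂ) + z‖ ≤ approxDensity N t / ((t + x) / 2) :=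
          div_le_div_of_nonneg_left (approxDensity_nonneg N ht0 hn) (by linarith) h2
      _ = 2 * (approxDensity N t / (t + x)) := by field_simp
  · exact ae_restrict_Ioi_of_forall_natCast_ne fun t ht hn => mul_nonneg two_pos.le
      (div_nonneg (approxDensity_nonneg _ ht hn) (by linarith))

lemma tendsto_quotient_natCast :
    Tendsto (fun n : ℕ => complexLogGamma ((n : ℝ) + 1) / ((n : ℝ) * Complex.log (n : ℝ))) atTop
      (𝓝 1) := by
  have h := (Complex.continuous_ofReal.tendsto _).comp tendsto_log_factorial_div
  rw [Complex.ofReal_one] at h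
  refine h.congr' ?_
  filter_upwards [eventually_gt_atTop 0] with n hn
  rw [complexLogGamma_ofReal_add_one (by exact_mod_cast hn), Real.Gamma_nat_eq_factorial,
    Function.comp_apply, Complex.ofReal_div, Complex.ofReal_mul, Complex.ofReal_log n.cast_nonneg]

/-- The integral representation off `z = 1`. Letting `N → ∞` and then `M → ∞` in the tail
estimate bounds the defect of the representation at `z` by twice the distance from `1` of the
quotient at `x`, which is small for large `x`. -/
theorem integral_density {z : ℂ} (hz : z ∈ Complex.slitPlane) (hz1 : z ≠ 1) :
    complexLogGamma (z + 1) / (z * Complex.log z) =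
      1 - ∫ t in Ioi (0 : ℝ), (density t : ℂ) / (t + z) := by
  have hbound : ∀ x : ℕ, 1 < x →
      ‖1 - complexLogGamma (z + 1) / (z * Complex.log z) -
        ∫ t in Ioi (0 : ℝ), (density t : ℂ) / (t + z)‖ ≤
      2 * ‖1 - complexLogGamma ((x : ℝ) + 1) / ((x : ℝ) * Complex.log (x : ℝ))‖ := by
    intro x hx
    have hx' : (1 : ℝ) < x := by exact_mod_cast hx
    have hlim := intervalIntegral_tendsto_integral_Ioi 0
      (integrableOn_stieltjes_slitPlane integrableOn_density hz)
      (tendsto_natCast_atTop_atTop (R := ℝ))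
    refine le_of_tendsto (hlim.const_sub _).norm ?_
    filter_upwards [tendsto_natCast_atTop_atTop.eventually
      (eventually_ge_atTop ((x : ℝ) + 2 * ‖z‖))] with M hM
    rw [intervalIntegral.integral_of_le (Nat.cast_nonneg M)]
    refine le_of_tendsto_of_tendsto ((tendsto_approxQuotient hz).sub
      (tendsto_integral_Ioc_approxDensity hz M)).norm
      ((tendsto_approxQuotient (z := ((x : ℝ) : ℂ)) (Or.inl ?_)).norm.const_mul 2) ?_
    · rw [Complex.ofReal_re]
      linarith
    · filter_upwards [eventually_gt_atTop 0] with N hN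
      exact norm_integral_approxDensity_tail_le hN hz hz1 hx' hM
  have hzero : ‖1 - complexLogGamma (z + 1) / (z * Complex.log z) -
        ∫ t in Ioi (0 : ℝ), (density t : ℂ) / (t + z)‖ ≤ 0 := by
    have h := ((tendsto_quotient_natCast.const_sub 1).norm).const_mul 2
    rw [sub_self, norm_zero, mul_zero] at h
    refine ge_of_tendsto h ?_
    filter_upwards [eventually_gt_atTop 1] with x hx using hbound x hx
  have h0 := norm_eq_zero.1 (le_antisymm hzero (norm_nonneg _))
  linear_combination -h0

/-! ### Consequences of the representation -/

/-- The holomorphic continuation of `log Γ (z + 1) / (z log z)` to the slit plane. -/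
noncomputable def gammaQuotient (z : ℂ) : ℂ :=
  1 - ∫ t in Ioi (0 : ℝ), (density t : ℂ) / (t + z)

lemma differentiableOn_gammaQuotient : DifferentiableOn ℂ gammaQuotient Complex.slitPlane := by
  intro z hz
  obtain ⟨c, hc, h⟩ := exists_pos_le_norm_add hz
  have := (hasDerivAt_stieltjes (𝕜 := ℂ) integrableOn_density hc h 0).const_sub 1
  simp only [zero_add, pow_one] at this
  exact this.differentiableAt.differentiableWithinAt

lemma gammaQuotient_ofReal (x : ℝ) :
    gammaQuotient x = ((1 - ∫ t in Ioi (0 : ℝ), density t / (t + x) : ℝ) : ℂ) := by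
  rw [gammaQuotient, ofReal_integral_div_add]
  push_cast
  rfl

lemma isNevanlinnaPick_gammaQuotient : IsNevanlinnaPick gammaQuotient := by
  have hmem : ∀ z : ℂ, 0 < z.im → z ∈ Complex.slitPlane := fun z hz => Or.inr hz.ne'
  refine ⟨differentiableOn_gammaQuotient.mono hmem, fun z hz => ?_⟩
  have him := integral_im (𝕜 := ℂ) (integrableOn_stieltjes_slitPlane integrableOn_density (hmem z hz))
  have hle : ∫ t in Ioi (0 : ℝ), RCLike.im ((density t : ℂ) / (t + z)) ≤ 0 := by
    refine integral_nonpos_of_ae (ae_restrict_Ioi_of_forall_natCast_ne fun t ht hn => ?_)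
    show ((density t : ℂ) / (t + z)).im ≤ 0
    rw [div_eq_mul_inv, Complex.im_ofReal_mul, Complex.inv_im, Complex.add_im, Complex.ofReal_im,
      zero_add]
    exact mul_nonpos_of_nonneg_of_nonpos (density_nonneg ht hn)
      (div_nonpos_of_nonpos_of_nonneg (by linarith) (Complex.normSq_nonneg _))
  rw [gammaQuotient, Complex.sub_im, Complex.one_im]
  rw [him] at hle
  have : (∫ t in Ioi (0 : ℝ), (density t : ℂ) / (t + z)).im ≤ 0 := hle
  linarith

/-- If the integral vanished, the density would be zero almost everywhere and the quotient would
be identically `1`; but its value at `2` is `1 / 2`. -/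
lemma integral_density_pow_pos (n : ℕ) {x : ℝ} (hx : 0 < x) :
    0 < ∫ t in Ioi (0 : ℝ), density t / (t + x) ^ (n + 1) := by
  have hnn : ∀ᵐ t ∂volume.restrict (Ioi (0 : ℝ)), 0 ≤ density t / (t + x) ^ (n + 1) :=
    ae_restrict_Ioi_of_forall_natCast_ne fun t ht hn => div_nonneg (density_nonneg ht hn) (by positivity)
  have hint : IntegrableOn (fun t => density t / (t + x) ^ (n + 1)) (Ioi 0) := by
    have := integrableOn_stieltjes (𝕜 := ℝ) integrableOn_density hx (z := x) (fun t ht => by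
      rw [RCLike.ofReal_real_eq_id, id, Real.norm_of_nonneg (by linarith)]
      linarith) n
    simpa only [RCLike.ofReal_real_eq_id, id] using this
  refine lt_of_le_of_ne (integral_nonneg_of_ae hnn) fun h0 => ?_
  have hae := (integral_eq_zero_iff_of_nonneg_ae hnn hint).1 h0.symm
  have hint0 : ∫ t in Ioi (0 : ℝ), (density t : ℂ) / (t + (2 : ℝ)) = 0 := by
    rw [ofReal_integral_div_add, Complex.ofReal_eq_zero]
    refine integral_eq_zero_of_ae ?_
    filter_upwards [hae, ae_restrict_mem measurableSet_Ioi] with t h ht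
    have hpos : 0 < t + x := add_pos ht hx
    have hd : density t = 0 := by
      rcases div_eq_zero_iff.1 (show density t / (t + x) ^ (n + 1) = 0 from h) with h | h
      · exact h
      · exact absurd h (by positivity)
    simp [hd]
  have h2 := integral_density (z := ((2 : ℝ) : ℂ)) (Or.inl (by simp)) (by norm_num)
  have hG : Real.Gamma (2 + 1) = 2 := by
    have := Real.Gamma_nat_eq_factorial 2
    norm_num at this ⊢
  rw [hint0, complexLogGamma_ofReal_add_one two_pos, hG, ← Complex.ofReal_log two_pos.le,
    sub_zero] at h2
  have hl : (Real.log 2 : ℂ) ≠ 0 := by exact_mod_cast (Real.log_pos one_lt_two).ne'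
  field_simp at h2
  norm_num at h2

lemma iteratedDeriv_gammaQuotient_sign {n : ℕ} (hn : 1 ≤ n) {x : ℝ} (hx : 0 < x) :
    0 < (-1 : ℝ) ^ (n - 1) * iteratedDeriv n (fun y : ℝ => (gammaQuotient y).re) x := by
  obtain ⟨k, rfl⟩ := Nat.exists_eq_add_of_le' hn
  have hfun : (fun y : ℝ => (gammaQuotient y).re) =
      fun y : ℝ => 1 - ∫ t in Ioi (0 : ℝ), density t / (t + y) := by
    ext y
    rw [gammaQuotient_ofReal, Complex.ofReal_re]
  rw [hfun, iteratedDeriv_const_sub (Nat.succ_pos k), iteratedDeriv_neg,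
    iteratedDeriv_stieltjes integrableOn_density (k + 1) hx, Nat.add_sub_cancel]
  have h1 := integral_density_pow_pos (k + 1) hx
  have h2 : ((-1 : ℝ) ^ k) * (-1) ^ k = 1 := by rw [← mul_pow]; norm_num
  have h3 : (-1 : ℝ) ^ k * -((-1) ^ (k + 1) * (k + 1).factorial *
      ∫ t in Ioi (0 : ℝ), density t / (t + x) ^ (k + 1 + 1)) =
      (k + 1).factorial * ∫ t in Ioi (0 : ℝ), density t / (t + x) ^ (k + 1 + 1) := by
    rw [pow_succ]
    linear_combination ((k + 1).factorial *
      ∫ t in Ioi (0 : ℝ), density t / (t + x) ^ (k + 1 + 1)) * h2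
  rw [h3]
  positivity

lemma ae_pickDensity_neg_eq (z : ℂ) :
    (fun t : ℝ => (density t : ℂ) / (t + z)) =ᵐ[volume.restrict (Ioi 0)]
      fun t : ℝ => ((pickDensity (-t)).toReal : ℂ) / (t + z) :=
  ae_restrict_Ioi_of_forall_natCast_ne fun t ht hn => by
    simp only [pickDensity_neg ht hn, EReal.toReal_coe]

end Representation

theorem mainTheorem1 :
    -- the density is non-negative
    (∀ t : ℝ, 0 ≤ pickDensity t) ∧
    ∃ f : ℂ → ℂ,
      -- `f` is the holomorphic extension of `log Γ(z + 1) / (z log z)` to the cut plane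
      DifferentiableOn ℂ f Complex.slitPlane ∧
      (∀ z ∈ Complex.slitPlane, z ≠ 1 →
        f z = complexLogGamma (z + 1) / (z * Complex.log z)) ∧
      -- on the positive half-line it is real, and given by the real quotient
      (∀ x : ℝ, 0 < x → (f x).im = 0) ∧
      (∀ x : ℝ, 0 < x → x ≠ 1 →
        (f x).re = Real.log (Real.Gamma (x + 1)) / (x * Real.log x)) ∧
      IsNevanlinnaPick f ∧
      -- the integral representation (`d` is finite almost everywhere)
      (∀ z ∈ Complex.slitPlane,
        IntegrableOn (fun t : ℝ => ((pickDensity (-t)).toReal : ℂ) / ((t : ℂ) + z)) (Ioi 0) ∧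
        f z = 1 - ∫ t in Ioi (0 : ℝ), ((pickDensity (-t)).toReal : ℂ) / ((t : ℂ) + z)) ∧
      -- the signs of the derivatives
      (∀ n : ℕ, 1 ≤ n → ∀ x : ℝ, 0 < x →
        0 < (-1 : ℝ) ^ (n - 1) * iteratedDeriv n (fun y : ℝ => (f y).re) x) := by
  refine ⟨pickDensity_nonneg, gammaQuotient, differentiableOn_gammaQuotient,
    fun z hz hz1 => (integral_density hz hz1).symm, fun x hx => ?_, fun x hx hx1 => ?_,
    isNevanlinnaPick_gammaQuotient, fun z hz => ⟨?_, ?_⟩,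
    fun n hn x hx => iteratedDeriv_gammaQuotient_sign hn hx⟩
  · rw [gammaQuotient_ofReal, Complex.ofReal_im]
  · rw [gammaQuotient, ← integral_density (Or.inl (by simpa using hx)) (by exact_mod_cast hx1),
      complexLogGamma_ofReal_add_one hx, ← Complex.ofReal_log hx.le, ← Complex.ofReal_mul,
      ← Complex.ofReal_div, Complex.ofReal_re]
  · exact (integrableOn_stieltjes_slitPlane integrableOn_density hz).congr (ae_pickDensity_neg_eq z)
  · rw [gammaQuotient, integral_congr_ae (ae_pickDensity_neg_eq z)]
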